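/- A \emph{round counter} is a function $\bar r:\mathbb{Z}_+\to\mathbb{Z}_+\cup\{\bot\}$, $\mathbb{Z}_+=\{0,1,2,\dots\}$, whose support $\operatorname{supp}\bar r=\{i\mid \bar r(i)\neq\bot\}$ is finite. A \emph{witness prestructure} is a sequence $\sigma=((W_0,G_0),\dots,(W_t,G_t))$, $t\ge 0$, of pairs of finite subsets of $\mathbb{Z}_+$ such that $W_i,G_i\subseteq W_0$ for $1\le i\le t$, $G_i\cap G_j=\emptyset$ for $0\le i<j\le t$, and $G_i\cap W_j=\emptyset$ for $0\le i\le j\le t$. It is a \emph{witness structure} if moreover $W_1,\dots,W_t$ are nonempty. Put $R_i=W_i\cup G_i$, $\operatorname{supp}\sigma=R_0$, $G(\sigma)=G_0\cup\dots\cup G_t$, $A(\sigma)=\operatorname{supp}\sigma\setminus G(\sigma)$, and $M(p,\sigma)=|\{0\le i\le t\mid p\in R_i\}|$ for $p\in\operatorname{supp}\sigma$. For a witness structure $\sigma$ and $S\subseteq A(\sigma)$ the witness structure $\Gamma_S(\sigma)$ (\emph{ghosting} of $S$) is obtained as follows. Let $D=S\cup G(\sigma)$, and let $q$ be the largest index with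 $R_q\not\subseteq D$ ($q=0$ if there is none). For $0\le i\le q$ let $G'_i$ be the set of all $p\in R_i\cap D$ with $p\notin R_j$ for $i<j\le q$, and let $W'_i=R_i\setminus G'_i$. Then, in $((W'_0,G'_0),\dots,(W'_q,G'_q))$, delete every pair with $i\ge 1$ and $W'_i=\emptyset$, and add its set $G'_i$ to the second set of the next pair that is not deleted. The \emph{immediate snapshot complex} $P(\bar r)$ is the abstract simplicial complex whose simplices are indexed by the witness structures $\sigma$ with $\operatorname{supp}\sigma=\operatorname{supp}\bar r$, $M(p,\sigma)=\bar r(p)+1$ for all $p\in A(\sigma)$, and $M(p,\sigma)\le\bar r(p)+1$ for all $p\in G(\sigma)$. The vertices of the simplex indexed by $\sigma$ are $\Gamma_{A(\sigma)\setminus\{a\}}(\sigma)$, $a\in A(\sigma)$; in particular the unique $\sigma$ with $A(\sigma)=\emptyset$ indexes the empty simplex. \textbf{Corollary.} For every round counter $\bar r$ with $\operatorname{supp}\bar r\neq\emptyset$, the simplicial complex $P(\bar r)$ is contractible, i.e. its geometric realization is a contractible topological space. -/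

import Mathlib

namespace ImmediateSnapshot

/-! ### Round counters -/

/-- A round counter: a function from the nonnegative integers to the nonnegative integers together
with an extra symbol `⊥`, taking values different from `⊥` at finitely many places only. -/
structure RoundCounter where
  /-- the underlying function -/
  toFun : ℕ → WithBot ℕ
  /-- the support is finite -/
  finite_support : {i | toFun i ≠ ⊥}.Finite

/-- The support set of a round counter. -/
noncomputable def RoundCounter.supp (r : RoundCounter) : Finset ℕ :=
  r.finite_support.toFinset

/-! ### Witness structures -/

/-- A pair `(W, G)` of finite sets of nonnegative integers, a column of the table presentation. -/
@[ext]
structure Pair where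
  /-- the upper entry `W` -/
  W : Finset ℕ
  /-- the lower entry `G` -/
  G : Finset ℕ
  deriving DecidableEq

/-- `R = W ∪ G`. -/
def Pair.R (x : Pair) : Finset ℕ := x.W ∪ x.G

/-- A nonempty sequence `((W₀, G₀), (W₁, G₁), …, (W_t, G_t))` of pairs of finite sets, `t ≥ 0`. -/
@[ext]
structure Table where
  /-- the pair `(W₀, G₀)` -/
  head : Pair
  /-- the pairs `(W₁, G₁), …, (W_t, G_t)` -/
  tail : List Pair
  deriving DecidableEq

namespace Table

/-- The list of all pairs `(W₀, G₀), …, (W_t, G_t)`. -/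
def pairs (σ : Table) : List Pair := σ.head :: σ.tail

/-- Witness prestructures. -/
structure IsWitnessPrestructure (σ : Table) : Prop where
  /-- `W_i, G_i ⊆ W₀` for `1 ≤ i ≤ t` -/
  P1 : ∀ x ∈ σ.tail, x.W ⊆ σ.head.W ∧ x.G ⊆ σ.head.W
  /-- `G_i ∩ G_j = ∅` for `0 ≤ i < j ≤ t` -/
  P2 : σ.pairs.Pairwise fun x y => Disjoint x.G y.G
  /-- `G_i ∩ W_i = ∅` for `0 ≤ i ≤ t` -/
  P3_eq : ∀ x ∈ σ.pairs, Disjoint x.G x.W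
  /-- `G_i ∩ W_j = ∅` for `0 ≤ i < j ≤ t` -/
  P3_lt : σ.pairs.Pairwise fun x y => Disjoint x.G y.W

/-- Witness structures: witness prestructures with `W₁, …, W_t` nonempty. -/
structure IsWitnessStructure (σ : Table) : Prop extends IsWitnessPrestructure σ where
  /-- `W_i` is nonempty for `1 ≤ i ≤ t` -/
  nonempty_W : ∀ x ∈ σ.tail, x.W.Nonempty

/-- The support `W₀ ∪ G₀`. -/
def supp (σ : Table) : Finset ℕ := σ.head.R

/-- The ghost set `G₀ ∪ ⋯ ∪ G_t`. -/
def ghost (σ : Table) : Finset ℕ := σ.pairs.toFinset.biUnion Pair.G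

/-- The active set, the complement of the ghost set in the support. -/
def active (σ : Table) : Finset ℕ := σ.supp \ σ.ghost

/-- `M(p, σ)`: the number of indices `0 ≤ i ≤ t` with `p ∈ R_i`. -/
def M (p : ℕ) (σ : Table) : ℕ := σ.pairs.countP fun x => p ∈ x.R

/-! ### Stabilization, canonical form, ghosting -/

/-- The union of the sets `R` of the pairs in a list. -/
def unionR (l : List Pair) : Finset ℕ := l.toFinset.biUnion Pair.R

/-- The pair `x` of a table, with the pairs `l` after it, rewritten so that an element
`p ∈ R` is in the lower entry exactly if `p ∈ D` and this is the last pair with `p ∈ R`. -/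
def retag (D : Finset ℕ) (x : Pair) (l : List Pair) : Pair where
  W := x.R \ ((x.R ∩ D) \ unionR l)
  G := (x.R ∩ D) \ unionR l

/-- The table (as a list of pairs) with the same sets `R_i`, that is with the same traces, as
the given one and with `D` as set of ghosts. -/
def retagAll (D : Finset ℕ) : List Pair → List Pair
  | [] => []
  | x :: l => retag D x l :: retagAll D l

/-- The pairs up to the last one with `R ⊄ D`. -/
def truncate (D : Finset ℕ) (l : List Pair) : List Pair := l.rdropWhile fun x => x.R ⊆ D

/-- The stabilization `st_S(σ)`. With `D = S ∪ G(σ)`, all traces are truncated at the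
largest `q` such that `R_q ⊄ D` (at `q = 0` if there is no such index), and `D` is the
ghost set of the result. -/
def st (S : Finset ℕ) (σ : Table) : Table where
  head := retag (S ∪ σ.ghost) σ.head (truncate (S ∪ σ.ghost) σ.tail)
  tail := retagAll (S ∪ σ.ghost) (truncate (S ∪ σ.ghost) σ.tail)

/-- Delete the pairs with `W = ∅`, adding their lower entries to the lower entry of the next
pair with `W ≠ ∅`; `acc` collects the lower entries that wait to be added. -/
def mergeEmpty (acc : Finset ℕ) : List Pair → List Pair
  | [] => []
  | x :: l =>
    if x.W = ∅ then mergeEmpty (acc ∪ x.G) l else ⟨x.W, acc ∪ x.G⟩ :: mergeEmpty ∅ l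

/-- The canonical form `C(σ)` of a stable witness prestructure: if `0 = i₀ < i₁ < ⋯ < i_q` are `0`
and the indices `i ≥ 1` with `W_i ≠ ∅`, then the `k`-th pair of `C(σ)`, `k ≥ 1`, is
`(W_{i_k}, G_{i_{k-1}+1} ∪ ⋯ ∪ G_{i_k})`. -/
def canon (σ : Table) : Table := ⟨σ.head, mergeEmpty ∅ σ.tail⟩

/-- The ghosting operation `Γ_S(σ) = C(st_S(σ))`. -/
def Γ (S : Finset ℕ) (σ : Table) : Table := canon (st S σ)

/-- The vertices of the simplex indexed by `σ`: the witness structures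
`Γ_{A(σ) \ {a}}(σ)` for `a ∈ A(σ)`. -/
def vertices (σ : Table) : Finset Table := σ.active.image fun a => Γ (σ.active \ {a}) σ

/-- `σ` is one of the witness structures that index the simplices of `P(r)`. -/
structure IsSimplexOf (r : RoundCounter) (σ : Table) : Prop extends IsWitnessStructure σ where
  supp_eq : σ.supp = r.supp
  M_active : ∀ p ∈ σ.active, (σ.M p : WithBot ℕ) = r.toFun p + 1
  M_ghost : ∀ p ∈ σ.ghost, (σ.M p : WithBot ℕ) ≤ r.toFun p + 1

/-! ### Faces of simplices are simplices -/

theorem mem_unionR {p : ℕ} {l : List Pair} : p ∈ unionR l ↔ ∃ x ∈ l, p ∈ x.R := by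
  simp [unionR]

theorem mem_ghost {p : ℕ} {σ : Table} : p ∈ σ.ghost ↔ ∃ x ∈ σ.pairs, p ∈ x.G := by
  simp [ghost]

theorem unionR_cons (x : Pair) (l : List Pair) : unionR (x :: l) = x.R ∪ unionR l := by
  ext p; simp [mem_unionR]

theorem retag_R (D : Finset ℕ) (x : Pair) (l : List Pair) : (retag D x l).R = x.R := by
  ext p
  simp only [Pair.R, retag, Finset.mem_union, Finset.mem_sdiff, Finset.mem_inter]
  tauto

theorem unionR_retagAll (D : Finset ℕ) (l : List Pair) : unionR (retagAll D l) = unionR l := by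
  induction l with
  | nil => rfl
  | cons x l ih => simp [retagAll, unionR_cons, retag_R, ih]

theorem truncate_nil (D : Finset ℕ) : truncate D [] = [] := rfl

theorem truncate_cons (D : Finset ℕ) (x : Pair) (l : List Pair) :
    truncate D (x :: l) = if truncate D l = [] ∧ x.R ⊆ D then [] else x :: truncate D l := by
  unfold truncate
  induction l using List.reverseRecOn with
  | nil =>
    by_cases h : x.R ⊆ D <;> simp [List.rdropWhile, h]
  | append_singleton l y ih =>
    rw [← List.cons_append, List.rdropWhile_concat, List.rdropWhile_concat]
    by_cases h : y.R ⊆ D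
    · simpa [h] using ih
    · simp [h]

theorem truncate_sublist (D : Finset ℕ) (l : List Pair) : (truncate D l).Sublist l :=
  (List.rdropWhile_prefix (p := fun x : Pair => x.R ⊆ D) l).sublist

theorem retagAll_truncate_congr (D : Finset ℕ) {l l' : List Pair}
    (h : l.map Pair.R = l'.map Pair.R) :
    unionR (truncate D l) = unionR (truncate D l') ∧
      retagAll D (truncate D l) = retagAll D (truncate D l') ∧
      (truncate D l = [] ↔ truncate D l' = []) := by
  induction l generalizing l' with
  | nil =>
    cases l' with
    | nil => simp
    | cons y l' => simp at h
  | cons x l ih =>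
    cases l' with
    | nil => simp at h
    | cons y l' =>
      simp only [List.map_cons, List.cons.injEq] at h
      obtain ⟨i1, i2, i3⟩ := ih h.2
      simp only [truncate_cons, i3, h.1]
      split_ifs with hc
      · simp
      · simp [unionR_cons, retagAll, i1, i2, h.1, retag]

theorem map_R_retagAll (D : Finset ℕ) (l : List Pair) :
    (retagAll D l).map Pair.R = l.map Pair.R := by
  induction l with
  | nil => rfl
  | cons x l ih => simp [retagAll, retag_R, ih]

theorem truncate_truncate {D D' : Finset ℕ} (h : D ⊆ D') (l : List Pair) :
    truncate D' (truncate D l) = truncate D' l := by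
  induction l with
  | nil => rfl
  | cons x l ih =>
    rw [truncate_cons D, truncate_cons D']
    by_cases h1 : truncate D l = [] ∧ x.R ⊆ D
    · rw [if_pos h1, if_pos]
      · rfl
      · rw [h1.1] at ih
        exact ⟨ih.symm.trans (truncate_nil _), h1.2.trans h⟩
    · rw [if_neg h1, truncate_cons, ih]

theorem mem_G_retagAll {D : Finset ℕ} {l : List Pair} {p : ℕ} :
    (∃ x ∈ retagAll D l, p ∈ x.G) ↔ p ∈ D ∧ p ∈ unionR l := by
  induction l with
  | nil => simp [retagAll, unionR]
  | cons x l ih =>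
    simp only [retagAll, List.mem_cons, exists_eq_or_imp, ih, unionR_cons, retag,
      Finset.mem_sdiff, Finset.mem_inter, Finset.mem_union]
    tauto

theorem st_st {S T : Finset ℕ} {σ : Table} (h : (st S σ).ghost = S ∪ σ.ghost) :
    st T (st S σ) = st (T ∪ S) σ := by
  have hD : T ∪ (st S σ).ghost = T ∪ S ∪ σ.ghost := by rw [h, Finset.union_assoc]
  have hsub : S ∪ σ.ghost ⊆ T ∪ S ∪ σ.ghost := by
    rw [Finset.union_assoc]; exact Finset.subset_union_right
  obtain ⟨h1, h2, -⟩ := retagAll_truncate_congr (T ∪ S ∪ σ.ghost)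
    (map_R_retagAll (S ∪ σ.ghost) (truncate (S ∪ σ.ghost) σ.tail))
  rw [truncate_truncate hsub] at h1 h2
  ext1
  · rw [st, hD]
    simp only [st, retag, Pair.mk.injEq, h1]
    have := retag_R (S ∪ σ.ghost) σ.head (truncate (S ∪ σ.ghost) σ.tail)
    simp only [retag] at this
    rw [this]
    simp
  · rw [st, hD]
    exact h2

/-- No element of a lower entry occurs again. -/
structure Clean (l : List Pair) : Prop where
  lt : l.Pairwise fun x y => Disjoint x.G y.R
  eq : ∀ x ∈ l, Disjoint x.G x.W

theorem clean_cons {x : Pair} {l : List Pair} :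
    Clean (x :: l) ↔ Disjoint x.G x.W ∧ Disjoint x.G (unionR l) ∧ Clean l := by
  constructor
  · rintro ⟨h1, h2⟩
    rw [List.pairwise_cons] at h1
    refine ⟨h2 x (by simp), ?_, h1.2, fun y hy => h2 y (by simp [hy])⟩
    rw [unionR, Finset.disjoint_biUnion_right]
    intro y hy
    exact h1.1 y (by simpa using hy)
  · rintro ⟨h1, h2, h3, h4⟩
    rw [unionR, Finset.disjoint_biUnion_right] at h2
    refine ⟨List.pairwise_cons.2 ⟨fun y hy => h2 y (by simpa using hy), h3⟩, ?_⟩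
    intro y hy
    rcases List.mem_cons.1 hy with rfl | hy
    · exact h1
    · exact h4 y hy

theorem mergeEmpty_unionR_subset (acc : Finset ℕ) (l : List Pair) :
    unionR (mergeEmpty acc l) ⊆ acc ∪ unionR l := by
  induction l generalizing acc with
  | nil => simp [mergeEmpty, unionR]
  | cons x l ih =>
    intro p
    rw [mergeEmpty]
    split_ifs with h
    · intro hp
      have := ih _ hp
      simp only [unionR_cons, Pair.R, Finset.mem_union] at this ⊢
      tauto
    · intro hp
      have := @ih ∅ p
      simp only [unionR_cons, Pair.R, Finset.mem_union, Finset.notMem_empty, false_or]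
        at hp this ⊢
      tauto

theorem clean_retagAll (D : Finset ℕ) (l : List Pair) : Clean (retagAll D l) := by
  induction l with
  | nil => exact ⟨List.Pairwise.nil, by simp [retagAll]⟩
  | cons x l ih =>
    rw [retagAll, clean_cons, unionR_retagAll]
    exact ⟨Finset.disjoint_sdiff, Finset.sdiff_disjoint, ih⟩

theorem clean_mergeEmpty {acc : Finset ℕ} {l : List Pair} (h : Clean l)
    (hacc : Disjoint acc (unionR l)) : Clean (mergeEmpty acc l) := by
  induction l generalizing acc with
  | nil => exact ⟨List.Pairwise.nil, by simp [mergeEmpty]⟩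
  | cons x l ih =>
    rw [clean_cons] at h
    rw [unionR_cons, Finset.disjoint_union_right, Pair.R, Finset.disjoint_union_right] at hacc
    rw [mergeEmpty]
    split_ifs with hx
    · exact ih h.2.2 (Finset.disjoint_union_left.2 ⟨hacc.2, h.2.1⟩)
    · refine clean_cons.2 ⟨Finset.disjoint_union_left.2 ⟨hacc.1.1, h.1⟩, ?_,
        ih h.2.2 (Finset.disjoint_empty_left _)⟩
      refine Finset.disjoint_of_subset_right (mergeEmpty_unionR_subset _ _) ?_
      rw [Finset.empty_union]
      exact Finset.disjoint_union_left.2 ⟨hacc.2, h.2.1⟩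

theorem mergeEmpty_W {acc : Finset ℕ} {l : List Pair} :
    ∀ x ∈ mergeEmpty acc l, x.W.Nonempty := by
  induction l generalizing acc with
  | nil => simp [mergeEmpty]
  | cons x l ih =>
    rw [mergeEmpty]
    split_ifs with hx
    · exact ih
    · intro y hy
      rcases List.mem_cons.1 hy with rfl | hy
      · exact Finset.nonempty_iff_ne_empty.2 hx
      · exact ih y hy

theorem retag_W_ne_empty {D : Finset ℕ} {x : Pair} {l : List Pair} (h : ¬ x.R ⊆ D) :
    (retag D x l).W ≠ ∅ := by
  obtain ⟨p, hp, hpD⟩ := Finset.not_subset.1 h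
  refine Finset.ne_empty_of_mem (a := p) ?_
  simp [retag, hp, hpD]

theorem mem_G_mergeEmpty {D acc : Finset ℕ} {l : List Pair} (h : truncate D l ≠ []) {p : ℕ} :
    (∃ x ∈ mergeEmpty acc (retagAll D (truncate D l)), p ∈ x.G) ↔
      p ∈ acc ∨ ∃ x ∈ retagAll D (truncate D l), p ∈ x.G := by
  induction l generalizing acc with
  | nil => exact absurd rfl h
  | cons x l ih =>
    rw [truncate_cons] at h ⊢
    have hc : ¬ (truncate D l = [] ∧ x.R ⊆ D) := fun hc => h (if_pos hc)
    rw [if_neg hc, retagAll, mergeEmpty]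
    by_cases ht : truncate D l = []
    · have hW := retag_W_ne_empty (l := truncate D l) fun hx => hc ⟨ht, hx⟩
      rw [if_neg hW]
      simp [ht, retagAll, mergeEmpty]
    · split_ifs with hx
      · rw [ih ht]
        simp [or_assoc]
      · simp only [List.mem_cons, exists_eq_or_imp, ih ht, Finset.mem_union,
          Finset.notMem_empty, false_or, or_assoc]

theorem mem_ghost_Γ {S : Finset ℕ} {σ : Table} {p : ℕ} :
    p ∈ (Γ S σ).ghost ↔ p ∈ (st S σ).ghost := by
  simp only [mem_ghost, pairs, Γ, canon, List.mem_cons, exists_eq_or_imp]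
  by_cases ht : truncate (S ∪ σ.ghost) σ.tail = []
  · simp [st, ht, retagAll, mergeEmpty]
  · have := mem_G_mergeEmpty (acc := ∅) ht (p := p)
    simp only [Finset.notMem_empty, false_or] at this
    simp only [st, this]

theorem ghost_st {S : Finset ℕ} {σ : Table} (h : S ∪ σ.ghost ⊆ σ.supp) :
    (st S σ).ghost = S ∪ σ.ghost := by
  ext p
  simp only [mem_ghost, pairs, List.mem_cons, exists_eq_or_imp, st, mem_G_retagAll, retag,
    Finset.mem_sdiff, Finset.mem_inter]
  have := @h p
  rw [supp] at this
  tauto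

theorem ghost_Γ {S : Finset ℕ} {σ : Table} (h : S ∪ σ.ghost ⊆ σ.supp) :
    (Γ S σ).ghost = S ∪ σ.ghost := by
  rw [← ghost_st h]
  ext p
  exact mem_ghost_Γ

theorem supp_Γ (S : Finset ℕ) (σ : Table) : (Γ S σ).supp = σ.supp := by
  simp [supp, Γ, canon, st, retag_R]

theorem truncate_mergeEmpty {D acc : Finset ℕ} {l : List Pair} (hacc : acc ⊆ D)
    (hG : ∀ x ∈ l, x.G ⊆ D) :
    (truncate D (mergeEmpty acc l) = [] ↔ truncate D l = []) ∧
      (truncate D l ≠ [] →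
        unionR (truncate D (mergeEmpty acc l)) = acc ∪ unionR (truncate D l)) := by
  induction l generalizing acc with
  | nil => simp [mergeEmpty, truncate_nil]
  | cons x l ih =>
    have hGl : ∀ y ∈ l, y.G ⊆ D := fun y hy => hG y (by simp [hy])
    have hGx : x.G ⊆ D := hG x (by simp)
    rw [mergeEmpty]
    split_ifs with hx
    · have hR : x.R = x.G := by simp [Pair.R, hx]
      obtain ⟨i1, i2⟩ := ih (Finset.union_subset hacc hGx) hGl
      rw [i1, truncate_cons, hR]
      by_cases ht : truncate D l = []
      · simp [ht, hGx]
      · simp [ht, i2 ht, unionR_cons, hR]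
    · obtain ⟨i1, i2⟩ := ih (Finset.empty_subset D) hGl
      rw [truncate_cons, truncate_cons]
      have hR : (⟨x.W, acc ∪ x.G⟩ : Pair).R = acc ∪ x.R := by
        ext p; simp only [Pair.R, Finset.mem_union]; tauto
      have hiff : (⟨x.W, acc ∪ x.G⟩ : Pair).R ⊆ D ↔ x.R ⊆ D := by
        rw [hR, Finset.union_subset_iff]; exact and_iff_right hacc
      simp only [i1, hiff]
      split_ifs with hc
      · simp
      · refine ⟨by simp, fun _ => ?_⟩
        rw [unionR_cons, unionR_cons, hR]
        by_cases ht : truncate D l = []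
        · rw [ht, i1.2 ht]; simp [unionR]
        · rw [i2 ht]; simp

theorem mergeEmpty_retagAll {D acc acc' : Finset ℕ} {l : List Pair} (hacc : acc' ⊆ D)
    (hG : ∀ x ∈ l, x.G ⊆ D) (hl : Clean l) (hd : Disjoint acc' (unionR l)) :
    mergeEmpty acc (retagAll D (truncate D (mergeEmpty acc' l))) =
      mergeEmpty (acc ∪ acc') (retagAll D (truncate D l)) := by
  induction l generalizing acc acc' with
  | nil => simp [mergeEmpty, truncate_nil, retagAll]
  | cons x l ih =>
    have hGl : ∀ y ∈ l, y.G ⊆ D := fun y hy => hG y (by simp [hy])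
    have hGx : x.G ⊆ D := hG x (by simp)
    rw [clean_cons] at hl
    obtain ⟨hl1, hl2, hl3⟩ := hl
    rw [unionR_cons, Finset.disjoint_union_right] at hd
    have hsub : unionR (truncate D l) ⊆ unionR l := by
      intro p
      simp only [mem_unionR]
      rintro ⟨y, hy, hp⟩
      exact ⟨y, (truncate_sublist D l).subset hy, hp⟩
    rw [mergeEmpty]
    split_ifs with hx
    · have hR : x.R = x.G := by simp [Pair.R, hx]
      rw [ih (Finset.union_subset hacc hGx) hGl hl3
        (Finset.disjoint_union_left.2 ⟨hd.2, hl2⟩), truncate_cons, hR]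
      by_cases ht : truncate D l = []
      · simp [ht, hGx, retagAll, mergeEmpty]
      · have hg : (retag D x (truncate D l)).G = x.G := by
          ext p
          have h1 := @hGx p
          have h2 (hp : p ∈ x.G) := Finset.disjoint_left.1 hl2 hp
          have h3 := @hsub p
          simp only [retag, hR, Finset.mem_sdiff, Finset.mem_inter]
          tauto
        have hW : (retag D x (truncate D l)).W = ∅ := by
          have : (retag D x (truncate D l)).W = x.G \ (retag D x (truncate D l)).G := by
            rw [← hR]; rfl
          rw [this, hg, Finset.sdiff_self]
        simp [ht, retagAll, mergeEmpty, hW, hg, Finset.union_assoc]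
    · obtain ⟨i1, i2⟩ := truncate_mergeEmpty (D := D) (Finset.empty_subset D) hGl
      have hU : unionR (truncate D (mergeEmpty ∅ l)) = unionR (truncate D l) := by
        by_cases ht : truncate D l = []
        · rw [ht, i1.2 ht]
        · rw [i2 ht, Finset.empty_union]
      have hR : (⟨x.W, acc' ∪ x.G⟩ : Pair).R = acc' ∪ x.R := by
        ext p; simp only [Pair.R, Finset.mem_union]; tauto
      have hiff : (⟨x.W, acc' ∪ x.G⟩ : Pair).R ⊆ D ↔ x.R ⊆ D := by
        rw [hR, Finset.union_subset_iff]; exact and_iff_right hacc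
      simp only [truncate_cons, i1, hiff]
      split_ifs with hc
      · rfl
      · have hg : (retag D ⟨x.W, acc' ∪ x.G⟩ (truncate D (mergeEmpty ∅ l))).G =
            acc' ∪ (retag D x (truncate D l)).G := by
          ext p
          simp only [retag, hU, hR, Finset.mem_sdiff, Finset.mem_inter, Finset.mem_union]
          by_cases hp : p ∈ acc'
          · have h2 : p ∉ unionR (truncate D l) := fun h =>
              Finset.disjoint_left.1 hd.2 hp (hsub h)
            simp [hp, h2, hacc hp]
          · simp [hp]
        have hW : (retag D ⟨x.W, acc' ∪ x.G⟩ (truncate D (mergeEmpty ∅ l))).W =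
            (retag D x (truncate D l)).W := by
          ext p
          simp only [retag, hU, hR, Finset.mem_sdiff, Finset.mem_inter, Finset.mem_union]
          by_cases hp : p ∈ acc'
          · have h2 : p ∉ unionR (truncate D l) := fun h =>
              Finset.disjoint_left.1 hd.2 hp (hsub h)
            have h4 : p ∉ x.R := Finset.disjoint_left.1 hd.1 hp
            simp [hp, h2, h4, hacc hp]
          · simp [hp]
        rw [retagAll, retagAll, mergeEmpty, mergeEmpty, hW, hg,
          ih (Finset.empty_subset D) hGl hl3 (Finset.disjoint_empty_left _),
          ih (Finset.empty_subset D) hGl hl3 (Finset.disjoint_empty_left _)]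
        simp [Finset.union_assoc]

theorem st_Γ {S T : Finset ℕ} {σ : Table} (h : S ∪ σ.ghost ⊆ σ.supp) :
    Γ T (Γ S σ) = Γ T (st S σ) := by
  have hD : (Γ S σ).ghost = (st S σ).ghost := by rw [ghost_Γ h, ghost_st h]
  have hG : ∀ x ∈ (st S σ).tail, x.G ⊆ T ∪ (st S σ).ghost := by
    intro x hx p hp
    exact Finset.mem_union_right _ (mem_ghost.2 ⟨x, by simp [pairs, hx], hp⟩)
  have hcl : Clean (st S σ).tail := clean_retagAll _ _
  have htail := mergeEmpty_retagAll (acc := ∅) (Finset.empty_subset _) hG hcl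
    (Finset.disjoint_empty_left _)
  have hU : unionR (truncate (T ∪ (st S σ).ghost) (mergeEmpty ∅ (st S σ).tail)) =
      unionR (truncate (T ∪ (st S σ).ghost) (st S σ).tail) := by
    obtain ⟨i1, i2⟩ := truncate_mergeEmpty (Finset.empty_subset (T ∪ (st S σ).ghost)) hG
    by_cases ht : truncate (T ∪ (st S σ).ghost) (st S σ).tail = []
    · rw [ht, i1.2 ht]
    · rw [i2 ht, Finset.empty_union]
  have e1 : (Γ S σ).tail = mergeEmpty ∅ (st S σ).tail := rfl
  have e2 : (Γ S σ).head = (st S σ).head := rfl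
  ext1
  · change (st T (Γ S σ)).head = (st T (st S σ)).head
    rw [st, st, hD, e1, e2]
    simp only [retag, hU]
  · change mergeEmpty ∅ (st T (Γ S σ)).tail = mergeEmpty ∅ (st T (st S σ)).tail
    rw [st, st, hD, e1]
    simpa using htail

theorem Γ_Γ {S T : Finset ℕ} {σ : Table} (h : S ∪ σ.ghost ⊆ σ.supp) :
    Γ T (Γ S σ) = Γ (T ∪ S) σ := by
  rw [st_Γ h, Γ, st_st (ghost_st h), Γ]

theorem IsWitnessPrestructure.R_subset {σ : Table} (h : σ.IsWitnessPrestructure) :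
    ∀ x ∈ σ.tail, x.R ⊆ σ.head.W := fun x hx =>
  Finset.union_subset (h.P1 x hx).1 (h.P1 x hx).2

theorem IsWitnessPrestructure.ghost_subset {σ : Table} (h : σ.IsWitnessPrestructure) :
    σ.ghost ⊆ σ.supp := by
  intro p hp
  obtain ⟨x, hx, hp⟩ := mem_ghost.1 hp
  rw [supp, Pair.R, Finset.mem_union]
  rcases List.mem_cons.1 hx with rfl | hx
  · exact Or.inr hp
  · exact Or.inl ((h.P1 x hx).2 hp)

theorem union_ghost_subset {S : Finset ℕ} {σ : Table} (h : σ.IsWitnessPrestructure)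
    (hS : S ⊆ σ.active) : S ∪ σ.ghost ⊆ σ.supp :=
  Finset.union_subset (hS.trans Finset.sdiff_subset) h.ghost_subset

theorem isWitnessStructure_Γ {S : Finset ℕ} {σ : Table} (h : σ.IsWitnessPrestructure) :
    (Γ S σ).IsWitnessStructure := by
  have hU : unionR (Γ S σ).tail ⊆ unionR (truncate (S ∪ σ.ghost) σ.tail) := by
    have := mergeEmpty_unionR_subset ∅ (st S σ).tail
    rwa [Finset.empty_union, show unionR (st S σ).tail = _ from unionR_retagAll _ _] at this
  have hclean : Clean (Γ S σ).pairs := by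
    refine clean_cons.2 ⟨Finset.disjoint_sdiff, ?_, ?_⟩
    · exact Finset.disjoint_of_subset_right hU Finset.sdiff_disjoint
    · exact clean_mergeEmpty (clean_retagAll _ _) (Finset.disjoint_empty_left _)
  have hR : ∀ x ∈ (Γ S σ).tail, x.R ⊆ (Γ S σ).head.W := by
    intro x hx p hp
    have hp' := hU (mem_unionR.2 ⟨x, hx, hp⟩)
    obtain ⟨y, hy, hpy⟩ := mem_unionR.1 hp'
    have hps := h.R_subset y ((truncate_sublist _ _).subset hy) hpy
    simp only [Γ, canon, st, retag, Pair.R, Finset.mem_sdiff, Finset.mem_union] at hps hp' ⊢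
    tauto
  refine ⟨⟨?_, ?_, hclean.eq, ?_⟩, mergeEmpty_W⟩
  · exact fun x hx => Finset.union_subset_iff.1 (hR x hx)
  · exact hclean.lt.imp fun h => Finset.disjoint_of_subset_right Finset.subset_union_right h
  · exact hclean.lt.imp fun h => Finset.disjoint_of_subset_right Finset.subset_union_left h

theorem countP_retagAll (D : Finset ℕ) (l : List Pair) (p : ℕ) :
    (retagAll D l).countP (fun x => p ∈ x.R) = l.countP fun x => p ∈ x.R := by
  induction l with
  | nil => rfl
  | cons x l ih => simp only [retagAll, List.countP_cons, retag_R, ih]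

theorem countP_truncate {D : Finset ℕ} (l : List Pair) {p : ℕ} (hp : p ∉ D) :
    (truncate D l).countP (fun x => p ∈ x.R) = l.countP fun x => p ∈ x.R := by
  induction l with
  | nil => rfl
  | cons x l ih =>
    rw [truncate_cons]
    split_ifs with hc
    · rw [hc.1] at ih
      have : p ∉ x.R := fun h => hp (hc.2 h)
      rw [List.countP_cons, ← ih]
      simp [this]
    · simp only [List.countP_cons, ih]

theorem countP_mergeEmpty_le (acc : Finset ℕ) (l : List Pair) (p : ℕ) :
    (mergeEmpty acc l).countP (fun x => p ∈ x.R) ≤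
      l.countP (fun x => p ∈ x.R) + if p ∈ acc then 1 else 0 := by
  induction l generalizing acc with
  | nil => simp [mergeEmpty]
  | cons x l ih =>
    rw [mergeEmpty]
    split_ifs with hx hp hp
    · have := ih (acc ∪ x.G)
      simp only [Finset.mem_union, hp, true_or, if_true] at this
      rw [List.countP_cons]; omega
    · have := ih (acc ∪ x.G)
      simp only [Finset.mem_union, hp, false_or] at this
      rw [List.countP_cons]
      simpa [Pair.R, hx] using this
    · have := ih ∅
      simp only [Finset.notMem_empty, if_false] at this
      rw [List.countP_cons, List.countP_cons]
      split_ifs <;> omega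
    · have := ih ∅
      simp only [Finset.notMem_empty, if_false] at this
      rw [List.countP_cons, List.countP_cons]
      simp only [Pair.R, Finset.mem_union, hp, false_or] at this ⊢
      omega

theorem countP_mergeEmpty {acc : Finset ℕ} {l : List Pair} {p : ℕ} (hacc : p ∉ acc)
    (hG : ∀ x ∈ l, p ∉ x.G) :
    (mergeEmpty acc l).countP (fun x => p ∈ x.R) = l.countP fun x => p ∈ x.R := by
  induction l generalizing acc with
  | nil => simp [mergeEmpty]
  | cons x l ih =>
    have hGl : ∀ y ∈ l, p ∉ y.G := fun y hy => hG y (by simp [hy])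
    have hGx : p ∉ x.G := hG x (by simp)
    rw [mergeEmpty]
    split_ifs with hx
    · rw [ih (by simp [hacc, hGx]) hGl]
      simp [Pair.R, hx, hGx]
    · rw [List.countP_cons, List.countP_cons, ih (by simp) hGl]
      simp [Pair.R, hacc, hGx]

theorem M_Γ_le (S : Finset ℕ) (σ : Table) (p : ℕ) : (Γ S σ).M p ≤ σ.M p := by
  have h1 := countP_mergeEmpty_le ∅ (st S σ).tail p
  have h2 : (st S σ).tail.countP (fun x => p ∈ x.R) ≤ σ.tail.countP fun x => p ∈ x.R := by
    simp only [st, countP_retagAll]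
    exact (truncate_sublist _ _).countP_le
  simp only [M, pairs, Γ, canon, List.countP_cons]
  rw [show (st S σ).head.R = σ.head.R from retag_R _ _ _]
  simp only [Finset.notMem_empty, if_false] at h1
  omega

theorem M_Γ {S : Finset ℕ} {σ : Table} {p : ℕ} (hp : p ∉ S ∪ σ.ghost) :
    (Γ S σ).M p = σ.M p := by
  have hG : ∀ x ∈ (st S σ).tail, p ∉ x.G := fun x hx hpx =>
    hp (mem_G_retagAll.1 ⟨x, hx, hpx⟩).1
  have h1 := countP_mergeEmpty (Finset.notMem_empty p) hG
  simp only [M, pairs, Γ, canon, List.countP_cons]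
  rw [show (st S σ).head.R = σ.head.R from retag_R _ _ _, h1]
  simp only [st, countP_retagAll, countP_truncate _ hp]

theorem active_Γ {S : Finset ℕ} {σ : Table} (h : S ∪ σ.ghost ⊆ σ.supp) :
    (Γ S σ).active = σ.active \ S := by
  ext p
  simp only [active, supp_Γ, ghost_Γ h, Finset.mem_sdiff, Finset.mem_union]
  tauto

/-- Ghosting leads from simplices of `P(r)` to simplices of `P(r)`. -/
theorem IsSimplexOf.Γ {r : RoundCounter} {S : Finset ℕ} {σ : Table} (h : σ.IsSimplexOf r)
    (hS : S ⊆ σ.active) : (Γ S σ).IsSimplexOf r := by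
  have hsub := union_ghost_subset h.toIsWitnessPrestructure hS
  refine ⟨isWitnessStructure_Γ h.toIsWitnessPrestructure, (supp_Γ S σ).trans h.supp_eq, ?_, ?_⟩
  · intro p hp
    rw [active_Γ hsub, Finset.mem_sdiff] at hp
    rw [M_Γ, h.M_active p hp.1]
    have := hp.1
    simp only [active, Finset.mem_sdiff] at this
    simp [hp.2, this.2]
  · intro p hp
    refine le_trans (WithBot.coe_le_coe.2 (M_Γ_le S σ p)) ?_
    rw [ghost_Γ hsub, Finset.mem_union] at hp
    rcases hp with hp | hp
    · exact (h.M_active p (hS hp)).le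
    · exact h.M_ghost p hp

/-- The vertices of `Γ_S(σ)` are the vertices of `σ` that belong to elements outside `S`. -/
theorem vertices_Γ {S : Finset ℕ} {σ : Table} (h : σ.IsWitnessPrestructure)
    (hS : S ⊆ σ.active) :
    (Γ S σ).vertices = (σ.active \ S).image fun a => Table.Γ (σ.active \ {a}) σ := by
  have hsub := union_ghost_subset h hS
  rw [vertices, active_Γ hsub]
  refine Finset.image_congr fun a ha => ?_
  simp only [Finset.coe_sdiff, Set.mem_sdiff, Finset.mem_coe] at ha
  rw [Γ_Γ hsub]
  congr 1
  ext p
  have := @hS p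
  simp only [Finset.mem_union, Finset.mem_sdiff, Finset.mem_singleton]
  constructor
  · rintro (hp | hp)
    · tauto
    · exact ⟨this hp, fun e => ha.2 (e ▸ hp)⟩
  · tauto

end Table

/-! ### Immediate snapshot complexes -/

open Table in
/-- The immediate snapshot complex `P(r)`. Its nonempty simplices are indexed by the witness
structures `σ` that satisfy `IsSimplexOf r` and have nonempty active set (the one with
empty active set indexes the empty simplex, which is not listed among the faces of a
`PreAbstractSimplicialComplex`); the simplex indexed by `σ` has the vertex set `vertices σ`. -/
def P (r : RoundCounter) : PreAbstractSimplicialComplex Table where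
  faces := {s | ∃ σ : Table, σ.IsSimplexOf r ∧ σ.active.Nonempty ∧ s = σ.vertices}
  isRelLowerSet_faces := by
    rintro s ⟨σ, hσ, hne, rfl⟩
    refine ⟨hne.image _, fun s' hs' hne' => ?_⟩
    have hS : σ.active.filter (fun a => Γ (σ.active \ {a}) σ ∉ s') ⊆ σ.active :=
      Finset.filter_subset _ _
    have hs : s' = (Γ (σ.active.filter fun a => Γ (σ.active \ {a}) σ ∉ s') σ).vertices := by
      rw [vertices_Γ hσ.toIsWitnessPrestructure hS]
      ext v
      simp only [Finset.mem_image, Finset.mem_sdiff, Finset.mem_filter, not_and, not_not]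
      constructor
      · intro hv
        obtain ⟨a, ha, rfl⟩ := Finset.mem_image.1 (hs' hv)
        exact ⟨a, ⟨ha, fun _ => hv⟩, rfl⟩
      · rintro ⟨a, ⟨ha, h⟩, rfl⟩
        exact h ha
    refine ⟨_, hσ.Γ hS, ?_, hs⟩
    rw [hs] at hne'
    exact Finset.image_nonempty.1 hne'

/-- The geometric realization of an abstract simplicial complex in barycentric coordinates: the
points are the functions `x` from the vertices to `[0, ∞)` that vanish outside some face and have
sum `1`. As a subspace of `V → ℝ` it carries the usual topology whenever the complex is
finite, and all complexes `P r` are finite. -/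
def realization {V : Type*} (K : PreAbstractSimplicialComplex V) : Set (V → ℝ) :=
  {x | ∃ s ∈ K.faces, (∀ v, 0 ≤ x v) ∧ (∀ v, v ∉ s → x v = 0) ∧ ∑ v ∈ s, x v = 1}

end ImmediateSnapshot

namespace ImmediateSnapshot

/-! ### Absolute extensors -/

/-! A simplex of the complex is a face of one without ghosts, and those are executions: words of
nonempty sets in which each process `p` occurs as often as its counter says. The vertex of `p` in
such a facet is the view of `p`, that is, the execution cut after the last step of `p`, with last
occurrences of other processes known only up to merging. So the realization is `protocol` with empty
past (`realization_P`).

For a past `u`, a counter `c` and a set `I` of processes still running, `protocol` is shown to be a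
closed absolute extensor by induction on the number of remaining steps. With no step left it is one
closed simplex. Otherwise it is the union of pieces `X S`, where `S` is the next set, a nonempty
subset of the set `J` of processes that have a step left. The pieces are glued on in an order in
which larger sets precede their subsets. When `X S` is added, it meets the union of the earlier
pieces exactly in the executions where `S` moves and its members are then dropped, so that only `I \
S` goes on. This intersection is again a `protocol` with fewer remaining steps, and `S ≠ J` keeps `I
\ S` nonempty. Closed absolute extensors that meet in an absolute extensor have an absolute extensor
as union (`IsAbsoluteExtensor.union`), and a nonempty one is contractible.

The intersection rests on two facts about views. If the members of `S` do not move again, a process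
outside `S` cannot tell whether `S` moved just before the next set or together with it
(`view_append_cons_cons`). Conversely, if `T ⊈ S` and `p` has the same view whether `S` or `T` moves
next, then `p ∉ S` and `p` sees no later step of `S` (`notMem_upTo_of_view_eq`). The second fact is
proved with the clock of one process read at a given occurrence of another, a quantity that merging
does not affect. -/

/-- A set `X` is an absolute extensor if every continuous map from a closed subset of a metrizable
space to `X` extends to the whole space. -/
def IsAbsoluteExtensor {E : Type*} [TopologicalSpace E] (X : Set E) : Prop :=
  ∀ (Y : Type) [TopologicalSpace Y] [TopologicalSpace.MetrizableSpace Y] (A : Set Y), IsClosed A →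
    ∀ f : Y → E, ContinuousOn f A → Set.MapsTo f A X →
      ∃ g : Y → E, Continuous g ∧ (∀ y, g y ∈ X) ∧ Set.EqOn g f A

open Classical in
theorem exists_extension_union {E Y : Type*} [TopologicalSpace E] [TopologicalSpace Y]
    {A B : Set Y} (hA : IsClosed A) (hB : IsClosed B) {f g : Y → E}
    (hf : ContinuousOn f A) (hg : ContinuousOn g B) (h : ∀ y ∈ A, y ∈ B → f y = g y) :
    ∃ k : Y → E, ContinuousOn k (A ∪ B) ∧ Set.EqOn k f A ∧ Set.EqOn k g B := by
  have h1 : Set.EqOn (fun y => if y ∈ A then f y else g y) f A := fun y hy => if_pos hy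
  have h2 : Set.EqOn (fun y => if y ∈ A then f y else g y) g B := by
    intro y hy
    by_cases hyA : y ∈ A
    · simp [hyA, h y hyA hy]
    · simp [hyA]
  exact ⟨_, (hf.congr h1).union_of_isClosed (hg.congr h2) hA hB, h1, h2⟩

open Classical in
-- The points equidistant from the preimages `A₁`, `A₂` form a wall between them. The map is first
-- extended from `A₁ ∩ A₂` into `X₁ ∩ X₂` and used on the wall, then extended on each side into `X₁`
-- or `X₂`.
theorem IsAbsoluteExtensor.union {E : Type*} [TopologicalSpace E] {X₁ X₂ : Set E}
    (c₁ : IsClosed X₁) (c₂ : IsClosed X₂) (h₁ : IsAbsoluteExtensor X₁)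
    (h₂ : IsAbsoluteExtensor X₂) (h₁₂ : IsAbsoluteExtensor (X₁ ∩ X₂)) :
    IsAbsoluteExtensor (X₁ ∪ X₂) := by
  intro Y _ _ A hA f hf hfX
  let _ := TopologicalSpace.metrizableSpaceMetric Y
  set A₁ := A ∩ f ⁻¹' X₁
  set A₂ := A ∩ f ⁻¹' X₂
  have hA₁ : IsClosed A₁ := hf.preimage_isClosed_of_isClosed hA c₁
  have hA₂ : IsClosed A₂ := hf.preimage_isClosed_of_isClosed hA c₂
  have hA₁₂ : ∀ y ∈ A, y ∈ A₁ ∨ y ∈ A₂ := fun y hy =>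
    (hfX hy).imp (fun h => ⟨hy, h⟩) fun h => ⟨hy, h⟩
  -- Extended distances: an empty `A₁` or `A₂` is at distance `⊤`, so it needs no separate case.
  set d₁ : Y → ENNReal := fun y => Metric.infEDist y A₁
  set d₂ : Y → ENNReal := fun y => Metric.infEDist y A₂
  have hd₁ : Continuous d₁ := Metric.continuous_infEDist
  have hd₂ : Continuous d₂ := Metric.continuous_infEDist
  have hz₁ : ∀ y, y ∈ A₁ ↔ d₁ y = 0 := fun y => Metric.mem_iff_infEDist_zero_of_closed hA₁
  have hz₂ : ∀ y, y ∈ A₂ ↔ d₂ y = 0 := fun y => Metric.mem_iff_infEDist_zero_of_closed hA₂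
  have hB : IsClosed {y | d₁ y = d₂ y} := isClosed_eq hd₁ hd₂
  obtain ⟨g, hg, hgX, hgf⟩ := h₁₂ Y (A₁ ∩ A₂) (hA₁.inter hA₂) f
    (hf.mono fun y hy => hy.1.1) fun y hy => ⟨hy.1.2, hy.2.2⟩
  -- On the wall one distance vanishes only if both do, so the wall meets `A₁` inside `A₁ ∩ A₂`,
  -- where `g` agrees with `f`.
  have key₁ : ∀ y ∈ A₁, y ∈ {y | d₁ y = d₂ y} → f y = g y := fun y hy hyB =>
    (hgf ⟨hy, (hz₂ y).2 (hyB ▸ (hz₁ y).1 hy)⟩).symm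
  have key₂ : ∀ y ∈ A₂, y ∈ {y | d₁ y = d₂ y} → f y = g y := fun y hy hyB =>
    (hgf ⟨(hz₁ y).2 ((show d₁ y = d₂ y from hyB).trans ((hz₂ y).1 hy)), hy⟩).symm
  obtain ⟨k₁, hk₁, hkf₁, hkg₁⟩ := exists_extension_union hA₁ hB
    (hf.mono fun y hy => hy.1) hg.continuousOn key₁
  obtain ⟨k₂, hk₂, hkf₂, hkg₂⟩ := exists_extension_union hA₂ hB
    (hf.mono fun y hy => hy.1) hg.continuousOn key₂
  obtain ⟨e₁, he₁, heX₁, hek₁⟩ := h₁ Y _ (hA₁.union hB) k₁ hk₁ (by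
    rintro y (hy | hy)
    · rw [hkf₁ hy]; exact hy.2
    · rw [hkg₁ hy]; exact (hgX y).1)
  obtain ⟨e₂, he₂, heX₂, hek₂⟩ := h₂ Y _ (hA₂.union hB) k₂ hk₂ (by
    rintro y (hy | hy)
    · rw [hkf₂ hy]; exact hy.2
    · rw [hkg₂ hy]; exact (hgX y).2)
  refine ⟨fun y => if d₁ y ≤ d₂ y then e₁ y else e₂ y,
    Continuous.if_le he₁ he₂ hd₁ hd₂ fun y hy => ?_, fun y => ?_, fun y hy => ?_⟩
  · rw [hek₁ (Or.inr hy), hek₂ (Or.inr hy), hkg₁ hy, hkg₂ hy]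
  · dsimp only
    split_ifs
    · exact Or.inl (heX₁ y)
    · exact Or.inr (heX₂ y)
  · dsimp only
    split_ifs with h
    · have : y ∈ A₁ := by
        rcases hA₁₂ y hy with h' | h'
        · exact h'
        · rw [(hz₂ y).1 h'] at h
          exact (hz₁ y).2 (le_antisymm h zero_le)
      rw [hek₁ (Or.inl this), hkf₁ this]
    · have : y ∈ A₂ := by
        rcases hA₁₂ y hy with h' | h'
        · rw [(hz₁ y).1 h'] at h
          exact absurd zero_le h
        · exact h'
      rw [hek₂ (Or.inl this), hkf₂ this]

open Classical in
-- A contraction is an extension over `unitInterval × X` of the map that is the identity at time `0`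
-- and constant at time `1`. Metrizability of `E` makes this product an admissible test space.
theorem IsAbsoluteExtensor.contractibleSpace {E : Type} [TopologicalSpace E]
    [TopologicalSpace.MetrizableSpace E] {X : Set E} (h : IsAbsoluteExtensor X)
    (hne : X.Nonempty) : ContractibleSpace X := by
  obtain ⟨x₀, hx₀⟩ := hne
  let A : Set (unitInterval × X) := {y | y.1 = 0}
  let B : Set (unitInterval × X) := {y | y.1 = 1}
  have hA : IsClosed A := isClosed_eq continuous_fst continuous_const
  have hB : IsClosed B := isClosed_eq continuous_fst continuous_const
  obtain ⟨k, hk, hkA, hkB⟩ := exists_extension_union (f := fun y => (y.2 : E))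
    (g := fun _ => x₀) hA hB (by fun_prop) (by fun_prop) (by
      intro y hy hy'
      exact absurd ((show y.1 = 0 from hy).symm.trans hy') zero_ne_one)
  obtain ⟨g, hg, hgX, hgk⟩ := h _ (A ∪ B) (hA.union hB) k hk (by
    rintro y (hy | hy)
    · rw [hkA hy]; exact y.2.2
    · rw [hkB hy]; exact hx₀)
  rw [contractible_iff_id_nullhomotopic]
  refine ⟨⟨x₀, hx₀⟩, ⟨⟨⟨fun y => ⟨g y, hgX y⟩, hg.subtype_mk _⟩, fun x => ?_, fun x => ?_⟩⟩⟩
  · have hy : ((0, x) : unitInterval × X) ∈ A := rfl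
    exact Subtype.ext ((hgk (Or.inl hy)).trans (hkA hy))
  · have hy : ((1, x) : unitInterval × X) ∈ B := rfl
    exact Subtype.ext ((hgk (Or.inr hy)).trans (hkB hy))

/-! ### Closed simplices -/

/-- The closed simplex with vertex set `s`, in barycentric coordinates. -/
def closedSimplex {V : Type*} (s : Finset V) : Set (V → ℝ) :=
  {x | (∀ v, 0 ≤ x v) ∧ (∀ v, v ∉ s → x v = 0) ∧ ∑ v ∈ s, x v = 1}

theorem isClosed_closedSimplex {V : Type*} (s : Finset V) : IsClosed (closedSimplex s) := by
  simp only [closedSimplex, Set.ofPred_and, Set.ofPred_forall]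
  refine (isClosed_iInter fun v => ?_).inter ((isClosed_iInter fun v => isClosed_iInter fun _ => ?_).inter ?_)
  · exact isClosed_le continuous_const (continuous_apply v)
  · exact isClosed_eq (continuous_apply v) continuous_const
  · exact isClosed_eq (by fun_prop) continuous_const

theorem closedSimplex_mono {V : Type*} {s t : Finset V} (h : s ⊆ t) :
    closedSimplex s ⊆ closedSimplex t := fun x hx =>
  ⟨hx.1, fun v hv => hx.2.1 v fun h' => hv (h h'), by
    rw [← hx.2.2]; exact (Finset.sum_subset h fun v _ hv => hx.2.1 v hv).symm⟩

theorem mem_closedSimplex_inter {V : Type*} [DecidableEq V] {s t : Finset V} {x : V → ℝ}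
    (hs : x ∈ closedSimplex s) (ht : x ∈ closedSimplex t) : x ∈ closedSimplex (s ∩ t) := by
  refine ⟨hs.1, fun v hv => ?_, ?_⟩
  · by_cases h : v ∈ s
    · exact ht.2.1 v fun h' => hv (Finset.mem_inter.2 ⟨h, h'⟩)
    · exact hs.2.1 v h
  · rw [← hs.2.2]
    refine Finset.sum_subset Finset.inter_subset_left fun v hv hv' => ht.2.1 v fun h' => ?_
    exact hv' (Finset.mem_inter.2 ⟨hv, h'⟩)

theorem nonempty_of_mem_closedSimplex {V : Type*} {s : Finset V} {x : V → ℝ}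
    (h : x ∈ closedSimplex s) : s.Nonempty := by
  rw [Finset.nonempty_iff_ne_empty]
  rintro rfl
  simpa using h.2.2

theorem closedSimplex_nonempty {V : Type*} {s : Finset V} (hs : s.Nonempty) :
    (closedSimplex s).Nonempty := by
  classical
  obtain ⟨v, hv⟩ := hs
  refine ⟨Pi.single v 1, fun w => ?_, fun w hw => ?_, ?_⟩
  · by_cases h : w = v
    · subst h; simp
    · simp [h]
  · have : w ≠ v := fun h => hw (h ▸ hv)
    simp [this]
  · rw [Finset.sum_pi_single' v 1 s, if_pos hv]

theorem isAbsoluteExtensor_closedSimplex {V : Type*} {s : Finset V} (hs : s.Nonempty) :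
    IsAbsoluteExtensor (closedSimplex s) := by
  classical
  intro Y _ _ A hA f hf hfX
  obtain ⟨g, hg⟩ := ContinuousMap.exists_restrict_eq hA (⟨A.domRestrict f, hf.domRestrict⟩ : C(A, V → ℝ))
  have hgf : ∀ y ∈ A, g y = f y := fun y hy => congrArg (fun k => k ⟨y, hy⟩) hg
  let T : Y → ℝ := fun y => ∑ v ∈ s, max (g y v) 0
  have hT : Continuous T := by fun_prop
  have hT0 : ∀ y, 0 ≤ T y := fun y => Finset.sum_nonneg fun v _ => le_max_right _ _
  have hpos : ∀ y, 0 < max (T y) 1 := fun y => lt_max_of_lt_right one_pos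
  have hcard : (0 : ℝ) < s.card := by exact_mod_cast hs.card_pos
  -- Tietze's extension is pushed into the simplex: positive parts are taken on `s`, scaled down if
  -- their sum `T` exceeds `1`, and otherwise the deficit `1 - T` is shared equally. On `A` the sum
  -- is `1` and nothing changes.
  refine ⟨fun y v => if v ∈ s then max (g y v) 0 / max (T y) 1 + max (1 - T y) 0 / s.card else 0,
    ?_, fun y => ⟨fun v => ?_, fun v hv => if_neg hv, ?_⟩, fun y hy => ?_⟩
  · refine continuous_pi fun v => ?_
    split_ifs
    · refine Continuous.add (Continuous.div ?_ (by fun_prop) fun y => (hpos y).ne') (by fun_prop)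
      fun_prop
    · exact continuous_const
  · dsimp only
    split_ifs
    · have := (hpos y).le
      positivity
    · exact le_rfl
  · rw [Finset.sum_congr rfl fun v hv => if_pos hv, Finset.sum_add_distrib, ← Finset.sum_div,
      Finset.sum_const, nsmul_eq_mul, mul_div_cancel₀ _ hcard.ne']
    change T y / max (T y) 1 + max (1 - T y) 0 = 1
    rcases le_total (T y) 1 with h | h
    · rw [max_eq_right h, max_eq_left (by linarith)]; ring
    · rw [max_eq_left h, max_eq_right (by linarith), div_self (by linarith), add_zero]
  · have hx := hfX hy
    have hmax : ∀ v, max (g y v) 0 = f y v := fun v => by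
      rw [hgf y hy]; exact max_eq_left (hx.1 v)
    have hT1 : T y = 1 := by
      rw [← hx.2.2]; exact Finset.sum_congr rfl fun v _ => hmax v
    ext v
    dsimp only
    split_ifs with hv
    · rw [hT1, hmax]; simp
    · exact (hx.2.1 v hv).symm


open Table

/-! ### Views -/

/-- The pair `(S, ∅)`. -/
def column (S : Finset ℕ) : Pair := ⟨S, ∅⟩

theorem column_R (S : Finset ℕ) : (column S).R = S := by simp [column, Pair.R]

/-- The witness structure without ghosts with the given sets `W₀ = I`, `W₁, …, W_t`. -/
def schedule (I : Finset ℕ) (w : List (Finset ℕ)) : Table := ⟨column I, w.map column⟩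

/-- The vertex of the simplex indexed by `schedule I w` that belongs to `p`. -/
def view (I : Finset ℕ) (w : List (Finset ℕ)) (p : ℕ) : Table := Γ (I \ {p}) (schedule I w)

/-- The part of a list of sets up to the last set that contains `p`. -/
def upTo (p : ℕ) (w : List (Finset ℕ)) : List (Finset ℕ) := w.rdropWhile fun S => p ∉ S

theorem upTo_append_of_notMem {p : ℕ} {w w' : List (Finset ℕ)} (h : ∀ S ∈ w', p ∉ S) :
    upTo p (w ++ w') = upTo p w := by
  induction w' using List.reverseRecOn with
  | nil => simp
  | append_singleton l S ih =>
    rw [upTo, ← List.append_assoc, List.rdropWhile_concat_pos _ _ _ (by simp [h S (by simp)])]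
    exact ih fun T hT => h T (by simp [hT])

theorem upTo_append_of_mem {p : ℕ} {w w' : List (Finset ℕ)} (h : ∃ S ∈ w', p ∈ S) :
    upTo p (w ++ w') = w ++ upTo p w' := by
  induction w' using List.reverseRecOn with
  | nil => simp at h
  | append_singleton l S ih =>
    by_cases hS : p ∈ S
    · rw [upTo, ← List.append_assoc, List.rdropWhile_concat_neg _ _ _ (by simp [hS]), upTo,
        List.rdropWhile_concat_neg _ _ _ (by simp [hS]), List.append_assoc]
    · rw [upTo, ← List.append_assoc, List.rdropWhile_concat_pos _ _ _ (by simp [hS]), upTo,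
        List.rdropWhile_concat_pos _ _ _ (by simp [hS])]
      refine ih ?_
      obtain ⟨T, hT, hpT⟩ := h
      rcases List.mem_append.1 hT with hT | hT
      · exact ⟨T, hT, hpT⟩
      · rw [List.mem_singleton.1 hT] at hpT
        exact absurd hpT hS

theorem upTo_prefix (p : ℕ) (w : List (Finset ℕ)) : upTo p w <+: w :=
  List.rdropWhile_prefix _ _

theorem upTo_cons_of_mem {p : ℕ} {S : Finset ℕ} {w : List (Finset ℕ)} (h : p ∈ S) :
    upTo p (S :: w) = S :: upTo p w := by
  by_cases hw : ∃ T ∈ w, p ∈ T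
  · exact upTo_append_of_mem (w := [S]) hw
  · push Not at hw
    have h1 := upTo_append_of_notMem (w := [S]) hw
    have h2 := upTo_append_of_notMem (w := []) hw
    rw [List.nil_append] at h2
    rw [h2, ← List.singleton_append, h1]
    simp [upTo, List.rdropWhile, h]

theorem exists_eq_upTo_append (p : ℕ) (w : List (Finset ℕ)) :
    ∃ w', w = upTo p w ++ w' ∧ ∀ S ∈ w', p ∉ S := by
  induction w using List.reverseRecOn with
  | nil => exact ⟨[], by simp [upTo]⟩
  | append_singleton l S ih =>
    by_cases hS : p ∈ S
    · refine ⟨[], ?_, by simp⟩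
      rw [upTo, List.rdropWhile_concat_neg _ _ _ (by simp [hS]), List.append_nil]
    · obtain ⟨w', h1, h2⟩ := ih
      refine ⟨w' ++ [S], ?_, by simpa [or_imp, forall_and, hS] using h2⟩
      rw [upTo_append_of_notMem (by simpa using hS), ← List.append_assoc, ← h1]

theorem truncate_map_column {I : Finset ℕ} {w : List (Finset ℕ)} (p : ℕ) (hw : ∀ S ∈ w, S ⊆ I) :
    truncate (I \ {p}) (w.map column) = (upTo p w).map column := by
  induction w using List.reverseRecOn with
  | nil => rfl
  | append_singleton l S ih =>
    have hS : S ⊆ I \ {p} ↔ p ∉ S := by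
      rw [Finset.subset_sdiff, Finset.disjoint_singleton_right]
      exact and_iff_right (hw S (by simp))
    rw [List.map_append, List.map_singleton, truncate, List.rdropWhile_concat, upTo,
      List.rdropWhile_concat]
    simp only [column_R, hS]
    by_cases h : p ∈ S
    · simp [h]
    · simp only [h, not_false_eq_true, decide_true, if_true]
      exact ih fun T hT => hw T (by simp [hT])

theorem ghost_schedule (I : Finset ℕ) (w : List (Finset ℕ)) : (schedule I w).ghost = ∅ := by
  ext p
  simp [mem_ghost, pairs, schedule, column]

theorem supp_schedule (I : Finset ℕ) (w : List (Finset ℕ)) : (schedule I w).supp = I :=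
  column_R I

theorem active_schedule (I : Finset ℕ) (w : List (Finset ℕ)) : (schedule I w).active = I := by
  simp [active, ghost_schedule, supp_schedule]

/-- A view depends only on the execution up to the last step of `p`: a set lies in `I \ {p}` exactly
if it misses `p`, so truncation cuts there. -/
theorem view_eq {I : Finset ℕ} {w : List (Finset ℕ)} (p : ℕ) (hw : ∀ S ∈ w, S ⊆ I) :
    view I w p = ⟨retag (I \ {p}) (column I) ((upTo p w).map column),
      mergeEmpty ∅ (retagAll (I \ {p}) ((upTo p w).map column))⟩ := by
  have h : (⟨column I, w.map column⟩ : Table).ghost = ∅ := ghost_schedule I w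
  simp only [view, Γ, canon, st, schedule, h, Finset.union_empty, truncate_map_column p hw]

theorem active_view {I : Finset ℕ} {p : ℕ} (hp : p ∈ I) (w : List (Finset ℕ)) :
    (view I w p).active = {p} := by
  rw [view, active_Γ, active_schedule]
  · simpa using hp
  · simp [ghost_schedule, supp_schedule]

/-- A vertex remembers its process, as the only active element. -/
theorem eq_of_view_eq {I : Finset ℕ} {w w' : List (Finset ℕ)} {p q : ℕ} (hp : p ∈ I)
    (hq : q ∈ I) (h : view I w p = view I w' q) : p = q := by
  have := congrArg active h
  rw [active_view hp, active_view hq] at this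
  exact Finset.singleton_injective this

theorem view_append_of_notMem {I : Finset ℕ} {w w' : List (Finset ℕ)} {p : ℕ}
    (hw : ∀ S ∈ w, S ⊆ I) (hw' : ∀ S ∈ w', S ⊆ I) (h : ∀ S ∈ w', p ∉ S) :
    view I (w ++ w') p = view I w p := by
  rw [view_eq p hw, view_eq p, upTo_append_of_notMem h]
  intro S hS
  exact (List.mem_append.1 hS).elim (hw S) (hw' S)

theorem unionR_append (l l' : List Pair) : unionR (l ++ l') = unionR l ∪ unionR l' := by
  ext p; simp [mem_unionR, or_and_right, exists_or]

/-- Retagging a common prefix sees what follows only through its union, and merging passes on only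
an accumulated set; hence the hypothesis for all `acc`. -/
theorem mergeEmpty_retagAll_append_congr {D : Finset ℕ} {l₁ l₂ : List Pair}
    (hU : unionR l₁ = unionR l₂)
    (h : ∀ acc, mergeEmpty acc (retagAll D l₁) = mergeEmpty acc (retagAll D l₂))
    (l : List Pair) (acc : Finset ℕ) :
    mergeEmpty acc (retagAll D (l ++ l₁)) = mergeEmpty acc (retagAll D (l ++ l₂)) := by
  induction l generalizing acc with
  | nil => exact h acc
  | cons x l ih =>
    simp only [List.cons_append, retagAll, mergeEmpty, retag, unionR_append, hU, ih]

theorem mem_unionR_map_column {w : List (Finset ℕ)} {p : ℕ} :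
    p ∈ unionR (w.map column) ↔ ∃ S ∈ w, p ∈ S := by
  simp [mem_unionR, column_R]

/-- A set `S` of elements that do not occur again can be joined with the next set. -/
theorem view_append_cons_cons {I S T : Finset ℕ} {u w : List (Finset ℕ)} {p : ℕ}
    (hu : ∀ C ∈ u, C ⊆ I) (hw : ∀ C ∈ w, C ⊆ I) (hS : S ⊆ I) (hT : T ⊆ I)
    (hpS : p ∉ S) (hST : Disjoint S T) (hSw : ∀ C ∈ w, Disjoint S C) :
    view I (u ++ S :: T :: w) p = view I (u ++ (S ∪ T) :: w) p := by
  have h1 : ∀ C ∈ u ++ S :: T :: w, C ⊆ I := by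
    simp only [List.mem_append, List.mem_cons]
    rintro C (h | rfl | rfl | h)
    exacts [hu C h, hS, hT, hw C h]
  have h2 : ∀ C ∈ u ++ (S ∪ T) :: w, C ⊆ I := by
    simp only [List.mem_append, List.mem_cons]
    rintro C (h | rfl | h)
    exacts [hu C h, Finset.union_subset hS hT, hw C h]
  rw [view_eq p h1, view_eq p h2]
  by_cases hp : ∃ C ∈ T :: w, p ∈ C
  · obtain ⟨w', e1, e2, e3⟩ : ∃ w', upTo p (T :: w) = T :: w' ∧
        upTo p ((S ∪ T) :: w) = (S ∪ T) :: w' ∧ w' <+: w := by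
      refine ⟨upTo p w, ?_, ?_, upTo_prefix p w⟩
      · by_cases hpT : p ∈ T
        · exact upTo_cons_of_mem hpT
        · exact upTo_append_of_mem (w := [T]) (by simpa [hpT] using hp)
      · by_cases hpT : p ∈ T
        · exact upTo_cons_of_mem (Finset.mem_union_right S hpT)
        · exact upTo_append_of_mem (w := [S ∪ T]) (by simpa [hpT] using hp)
    have e4 : upTo p (u ++ S :: T :: w) = u ++ S :: T :: w' := by
      rw [List.append_cons u S, upTo_append_of_mem hp, e1]; simp
    have e5 : upTo p (u ++ (S ∪ T) :: w) = u ++ (S ∪ T) :: w' := by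
      rw [upTo_append_of_mem, e2]
      simpa [hpS] using hp
    have hSw' : ∀ q ∈ S, q ∉ unionR (w'.map column) := by
      intro q hq hqw
      obtain ⟨C, hC, hqC⟩ := mem_unionR_map_column.1 hqw
      exact Finset.disjoint_left.1 (hSw C (e3.subset hC)) hq hqC
    have hST' : ∀ q ∈ S, q ∉ T := fun q hq => Finset.disjoint_left.1 hST hq
    have hSI : ∀ q ∈ S, q ∈ I ∧ q ≠ p := fun q hq => ⟨hS hq, fun e => hpS (e ▸ hq)⟩
    have hU : unionR (List.map column (S :: T :: w')) =
        unionR (List.map column ((S ∪ T) :: w')) := by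
      simp [unionR_cons, column_R, Finset.union_assoc]
    rw [e4, e5, List.map_append, List.map_append]
    have hm := mergeEmpty_retagAll_append_congr (D := I \ {p}) hU (fun acc => ?_) (u.map column) ∅
    · rw [hm]
      simp only [retag, unionR_append, hU]
    -- Every member of `S` has its last occurrence here and is a ghost, so this column has an empty
    -- upper entry and merging hands `S` to the next column.
    · have w1 : retag (I \ {p}) (column S) (column T :: w'.map column) = ⟨∅, S⟩ := by
        ext q <;> by_cases hq : q ∈ S <;>
          simp [retag, column_R, unionR_cons, hq, hSw', hST', hSI]
      have w2 : retag (I \ {p}) (column (S ∪ T)) (w'.map column) =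
          ⟨(retag (I \ {p}) (column T) (w'.map column)).W,
            S ∪ (retag (I \ {p}) (column T) (w'.map column)).G⟩ := by
        ext q <;> by_cases hq : q ∈ S <;>
          simp [retag, column_R, hq, hSw', hST', hSI]
      simp only [List.map_cons, retagAll, w1, w2, mergeEmpty, if_true, Finset.union_assoc]
  · have hp' : ∀ C ∈ T :: w, p ∉ C := fun C hC hpC => hp ⟨C, hC, hpC⟩
    have e1 : upTo p (u ++ S :: T :: w) = upTo p u := upTo_append_of_notMem (by
      simpa [hpS] using hp')
    have e2 : upTo p (u ++ (S ∪ T) :: w) = upTo p u := upTo_append_of_notMem (by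
      simpa [hpS] using hp')
    rw [e1, e2]

/-! ### Clocks -/

/-- The number of pairs with `y ∈ R`, up to the pair where `x` occurs after `k` earlier
occurrences. -/
def clock (x y : ℕ) : ℕ → List Pair → ℕ
  | _, [] => 0
  | k, c :: l => (if y ∈ c.R then 1 else 0) +
      if x ∈ c.R then (if k = 0 then 0 else clock x y (k - 1) l) else clock x y k l

theorem clock_retagAll (D : Finset ℕ) (x y k : ℕ) (l : List Pair) :
    clock x y k (retagAll D l) = clock x y k l := by
  induction l generalizing k with
  | nil => rfl
  | cons c l ih => simp only [retagAll, clock, retag_R, ih]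

theorem countP_W_mergeEmpty (acc : Finset ℕ) (l : List Pair) (x : ℕ) :
    (mergeEmpty acc l).countP (fun c => x ∈ c.W) = l.countP fun c => x ∈ c.W := by
  induction l generalizing acc with
  | nil => rfl
  | cons c l ih =>
    rw [mergeEmpty]
    split_ifs with h
    · rw [ih, List.countP_cons]; simp [h]
    · rw [List.countP_cons, List.countP_cons, ih]

theorem countP_W_eq_zero {l : List Pair} {x : ℕ} (h : x ∉ unionR l) :
    l.countP (fun c => x ∈ c.W) = 0 := by
  rw [List.countP_eq_zero]
  intro c hc hx
  exact h (mem_unionR.2 ⟨c, hc, Finset.mem_union_left _ (by simpa using hx)⟩)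

/-- By `hk` the occurrence of `x` at which the clock stops lies in an upper entry, so its pair is
not deleted and everything deleted before it is merged no later than there. As `l` is clean, a
shifted `y` never lands in a pair that already contains it, so no count is lost. -/
theorem clock_mergeEmpty {l : List Pair} (hl : Clean l) {acc : Finset ℕ}
    (hacc : Disjoint acc (unionR l)) {x k : ℕ} (hx : x ∉ acc)
    (hk : k < l.countP fun c => x ∈ c.W) (y : ℕ) :
    clock x y k (mergeEmpty acc l) = (if y ∈ acc then 1 else 0) + clock x y k l := by
  induction l generalizing acc k with
  | nil => simp at hk
  | cons c l ih =>
    rw [clean_cons] at hl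
    obtain ⟨h1, h2, h3⟩ := hl
    rw [unionR_cons, Finset.disjoint_union_right] at hacc
    rw [List.countP_cons] at hk
    have hy : y ∈ acc → y ∉ c.R := fun h => Finset.disjoint_left.1 hacc.1 h
    rw [mergeEmpty]
    by_cases hW : c.W = ∅
    · rw [if_pos hW]
      -- A lower entry holds last occurrences only, which would leave no occurrence in an upper
      -- entry for `hk`.
      have hxG : x ∉ c.G := by
        intro hxG
        rw [countP_W_eq_zero (Finset.disjoint_left.1 h2 hxG)] at hk
        simp [hW] at hk
      have hR : c.R = c.G := by simp [Pair.R, hW]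
      rw [ih h3 (Finset.disjoint_union_left.2 ⟨hacc.2, h2⟩) (by simp [hx, hxG])
        (by simpa [hW] using hk), clock, hR, if_neg hxG]
      rw [hR] at hy
      simp only [Finset.mem_union]
      by_cases hya : y ∈ acc
      · simp [hya, hy hya]
      · simp [hya]
    · rw [if_neg hW]
      have hR : (⟨c.W, acc ∪ c.G⟩ : Pair).R = acc ∪ c.R := by
        ext p; simp only [Pair.R, Finset.mem_union]; tauto
      have hy' : (if y ∈ acc ∪ c.R then 1 else 0) =
          (if y ∈ acc then 1 else 0) + if y ∈ c.R then 1 else 0 := by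
        by_cases hya : y ∈ acc
        · simp [hya, hy hya]
        · simp [hya]
      have hx' : x ∈ acc ∪ c.R ↔ x ∈ c.R := by simp [hx]
      rw [clock, clock, hR, hy', add_assoc]
      simp only [hx']
      congr 2
      by_cases hxR : x ∈ c.R
      · by_cases hk0 : k = 0
        · simp [hk0, hxR]
        · simp only [hxR, hk0, if_true, if_false]
          rw [ih h3 (Finset.disjoint_empty_left _) (Finset.notMem_empty _)]
          · simp
          · split_ifs at hk <;> omega
      · have hxW : x ∉ c.W := fun h => hxR (Finset.mem_union_left _ h)
        simp only [hxR, if_false]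
        rw [ih h3 (Finset.disjoint_empty_left _) (Finset.notMem_empty _)]
        · simp
        · simpa [hxW] using hk

/-- Retagging lowers only the last occurrence of a member of `D`. The occurrences in `l` are
followed by the one in `c`, which `h` protects, so all of them stay in upper entries. This supplies
the bound on `k` in `clock_mergeEmpty`. -/
theorem countP_lt_countP_W_retagAll {D : Finset ℕ} {l l' : List Pair} {c : Pair} {x : ℕ}
    (hx : x ∈ c.R) (h : x ∉ D ∨ x ∈ unionR l') :
    (l.countP fun c => x ∈ c.R) <
      (retagAll D (l ++ c :: l')).countP fun c => x ∈ c.W := by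
  induction l with
  | nil =>
    have : x ∈ (retag D c l').W := by
      simp only [retag, Finset.mem_sdiff, Finset.mem_inter]
      tauto
    simp [retagAll, this]
  | cons a l ih =>
    have : x ∈ a.R → x ∈ (retag D a (l ++ c :: l')).W := by
      intro ha
      simp only [retag, Finset.mem_sdiff, Finset.mem_inter, unionR_append, unionR_cons,
        Finset.mem_union]
      tauto
    rw [List.cons_append, retagAll, List.countP_cons, List.countP_cons]
    by_cases ha : x ∈ a.R
    · simpa [ha, this ha] using ih
    · simp only [ha, decide_false]
      exact lt_of_lt_of_le ih (Nat.le_add_right _ _)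

theorem clock_append_cons {l l' : List Pair} {c : Pair} {x : ℕ} (hx : x ∈ c.R) (y : ℕ) :
    clock x y (l.countP fun c => x ∈ c.R) (l ++ c :: l') =
      (l.countP fun c => y ∈ c.R) + if y ∈ c.R then 1 else 0 := by
  induction l with
  | nil => simp [clock, hx]
  | cons a l ih =>
    rw [List.cons_append, clock, List.countP_cons, List.countP_cons]
    by_cases ha : x ∈ a.R
    · simp only [ha, decide_true, if_true, Nat.add_eq_zero_iff, one_ne_zero, and_false, if_false,
        Nat.add_sub_cancel, ih, decide_eq_true_eq]
      omega
    · simp only [ha, decide_false, if_false, Bool.false_eq_true, add_zero, ih, decide_eq_true_eq]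
      omega

/-- The clock cannot stop inside `l`, which has too few occurrences of `x`, so it counts `l` and `c`
completely. -/
theorem le_clock_append_cons {l l' : List Pair} {c : Pair} {x k : ℕ}
    (hk : (l.countP fun c => x ∈ c.R) ≤ k) (y : ℕ) :
    ((l.countP fun c => y ∈ c.R) + if y ∈ c.R then 1 else 0) ≤ clock x y k (l ++ c :: l') := by
  induction l generalizing k with
  | nil => simp [clock]
  | cons a l ih =>
    rw [List.cons_append, clock, List.countP_cons]
    rw [List.countP_cons] at hk
    by_cases ha : x ∈ a.R
    · simp only [ha, decide_true, if_true] at hk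
      have := ih (k := k - 1) (by omega)
      simp only [ha, if_true, decide_eq_true_eq, show k ≠ 0 by omega, if_false]
      omega
    · simp only [ha, decide_false, Bool.false_eq_true, if_false, add_zero] at hk
      have := ih hk
      simp only [ha, if_false, decide_eq_true_eq]
      omega

theorem countP_W_le_countP_R (D : Finset ℕ) (l : List Pair) (x : ℕ) :
    ((retagAll D l).countP fun c => x ∈ c.W) ≤ l.countP fun c => x ∈ c.R := by
  rw [← countP_retagAll D l x]
  refine List.countP_mono_left fun c _ hc => ?_
  simp only [decide_eq_true_eq] at hc ⊢
  exact Finset.mem_union_left _ hc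

/-- If the views of `p` agree, although the next sets `S` and `T ⊈ S` are different, then `p` has not
heard from the elements of `S` after their occurrence in `S`. -/
theorem notMem_upTo_of_view_eq {I S T : Finset ℕ} {u w w' : List (Finset ℕ)} {p : ℕ}
    (hw : ∀ C ∈ u ++ S :: w, C ⊆ I) (hw' : ∀ C ∈ u ++ T :: w', C ⊆ I) (hT : ¬ T ⊆ S)
    (h : view I (u ++ S :: w) p = view I (u ++ T :: w') p) {x : ℕ} (hx : x ∈ S) :
    x ≠ p ∧ ∀ C ∈ upTo p w, x ∉ C := by
  obtain ⟨y, hyT, hyS⟩ := Finset.not_subset.1 hT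
  rw [← not_exists_not (p := fun C => C ∈ upTo p w → x ∉ C), ← not_or]
  -- Negated claim: `x` is `p` itself or occurs again in what `p` sees. Either way its occurrence in
  -- `S` stays in an upper entry of the view.
  intro hx'
  have e1 : upTo p (u ++ S :: w) = u ++ S :: upTo p w := by
    by_cases hpS : p ∈ S
    · rw [upTo_append_of_mem ⟨S, by simp, hpS⟩, upTo_cons_of_mem hpS]
    · have hpw : ∃ C ∈ w, p ∈ C := by
        by_contra! hpw
        have := upTo_append_of_notMem (w := []) hpw
        rw [List.nil_append] at this
        rw [this] at hx'
        rcases hx' with rfl | hx'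
        · exact hpS hx
        · simp [upTo] at hx'
      rw [List.append_cons, upTo_append_of_mem hpw]; simp
  have htail := congrArg Table.tail h
  rw [view_eq p hw, view_eq p hw', e1] at htail
  dsimp only at htail
  -- The occurrence of `x` in `S` comes after exactly `k` earlier ones.
  set k := (u.map column).countP fun c => x ∈ c.R with hk
  have hkW : k < (retagAll (I \ {p}) ((u ++ S :: upTo p w).map column)).countP
      fun c => x ∈ c.W := by
    rw [List.map_append, List.map_cons]
    refine countP_lt_countP_W_retagAll (by rwa [column_R]) ?_
    rcases hx' with rfl | ⟨C, hC⟩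
    · exact Or.inl (by simp)
    · push Not at hC
      exact Or.inr (mem_unionR_map_column.2 ⟨C, hC⟩)
  have hkW' : k < (retagAll (I \ {p}) ((upTo p (u ++ T :: w')).map column)).countP
      fun c => x ∈ c.W := by
    rwa [← countP_W_mergeEmpty ∅, ← htail, countP_W_mergeEmpty]
  -- In the second execution `p` must see `T` as well: a view ending inside `u` has at most `k`
  -- occurrences of `x` in upper entries.
  have e2 : ∃ w₁, upTo p (u ++ T :: w') = u ++ T :: w₁ := by
    by_cases hp : ∃ C ∈ T :: w', p ∈ C
    · rw [upTo_append_of_mem hp]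
      by_cases hpT : p ∈ T
      · exact ⟨_, by rw [upTo_cons_of_mem hpT]⟩
      · exact ⟨upTo p w', by
          rw [← List.singleton_append, upTo_append_of_mem (by simpa [hpT] using hp)]; rfl⟩
    · push Not at hp
      rw [upTo_append_of_notMem hp] at hkW'
      have h1 := hkW'.trans_le (countP_W_le_countP_R _ _ _)
      have h2 : ((upTo p u).map column).Sublist (u.map column) :=
        (upTo_prefix p u).sublist.map _
      exact absurd h1 (not_lt.2 h2.countP_le)
  obtain ⟨w₁, e2⟩ := e2
  -- The contradiction: at this occurrence of `x` the first clock shows the steps of `y` in `u`,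
  -- because `y ∉ S`; the second shows at least one more, because `y ∈ T`.
  have hc := congrArg (clock x y k) htail
  rw [clock_mergeEmpty (clean_retagAll _ _) (Finset.disjoint_empty_left _)
      (Finset.notMem_empty _) hkW,
    clock_mergeEmpty (clean_retagAll _ _) (Finset.disjoint_empty_left _)
      (Finset.notMem_empty _) hkW', clock_retagAll, clock_retagAll, e2, List.map_append,
    List.map_append, List.map_cons, List.map_cons, hk,
    clock_append_cons (by rwa [column_R]), column_R, if_neg hyS] at hc
  have := le_clock_append_cons (c := column T) (l' := w₁.map column) (hk.symm.le) y
  rw [column_R, if_pos hyT] at this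
  rw [← hk] at hc
  omega


/-! ### Words -/

/-- A list of nonempty subsets of `I` in which every `p ∈ I` occurs `c p` times. -/
structure IsWord (c : ℕ → ℕ) (I : Finset ℕ) (w : List (Finset ℕ)) : Prop where
  nonempty : ∀ S ∈ w, S.Nonempty
  subset : ∀ S ∈ w, S ⊆ I
  count : ∀ p ∈ I, w.countP (fun S => p ∈ S) = c p

theorem countP_mem_eq_zero {w : List (Finset ℕ)} {p : ℕ} (h : ∀ S ∈ w, p ∉ S) :
    w.countP (fun S => p ∈ S) = 0 := by
  rw [List.countP_eq_zero]
  intro S hS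
  simpa using h S hS

theorem exists_isWord (c : ℕ → ℕ) (I : Finset ℕ) : ∃ w, IsWord c I w := by
  induction I using Finset.induction_on with
  | empty => exact ⟨[], by simp, by simp, by simp⟩
  | insert a I ha ih =>
    obtain ⟨w, h1, h2, h3⟩ := ih
    -- The processes run one after the other, each alone.
    refine ⟨w ++ List.replicate (c a) {a}, ?_, ?_, ?_⟩
    · intro S hS
      rcases List.mem_append.1 hS with hS | hS
      · exact h1 S hS
      · rw [List.eq_of_mem_replicate hS]; exact Finset.singleton_nonempty a
    · intro S hS
      rcases List.mem_append.1 hS with hS | hS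
      · exact (h2 S hS).trans (Finset.subset_insert _ _)
      · rw [List.eq_of_mem_replicate hS]; simp
    · intro p hp
      rw [List.countP_append, List.countP_replicate]
      rcases Finset.mem_insert.1 hp with rfl | hp
      · rw [countP_mem_eq_zero fun S hS h => ha (h2 S hS h)]; simp
      · have : p ≠ a := fun e => ha (e ▸ hp)
        simp [h3 p hp, this]

/-- The counter `c`, lowered by `1` on `S`. -/
def lower (c : ℕ → ℕ) (S : Finset ℕ) (p : ℕ) : ℕ := if p ∈ S then c p - 1 else c p

/-- The first set may contain only processes with a step left; this makes the truncated subtraction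
in `lower` harmless. -/
theorem isWord_cons {c : ℕ → ℕ} {I S : Finset ℕ} {w : List (Finset ℕ)} :
    IsWord c I (S :: w) ↔ S.Nonempty ∧ S ⊆ I.filter (fun p => c p ≠ 0) ∧ IsWord (lower c S) I w := by
  constructor
  · rintro ⟨h1, h2, h3⟩
    have h2S := h2 S (by simp)
    refine ⟨h1 S (by simp), fun p hp => ?_, fun T hT => h1 T (by simp [hT]),
      fun T hT => h2 T (by simp [hT]), fun p hp => ?_⟩
    · rw [Finset.mem_filter, ← h3 p (h2S hp), List.countP_cons]
      exact ⟨h2S hp, by simp [hp]⟩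
    · have := h3 p hp
      rw [List.countP_cons] at this
      simp only [lower, decide_eq_true_eq] at this ⊢
      split_ifs at this ⊢ <;> omega
  · rintro ⟨h1, h2, h3, h4, h5⟩
    refine ⟨by simpa [h1] using h3, ?_, fun p hp => ?_⟩
    · intro T hT
      rcases List.mem_cons.1 hT with rfl | hT
      · exact h2.trans (Finset.filter_subset _ _)
      · exact h4 T hT
    · rw [List.countP_cons, h5 p hp]
      by_cases hpS : p ∈ S
      · have := (Finset.mem_filter.1 (h2 hpS)).2
        simp only [lower, hpS, if_true, decide_true]
        omega
      · simp [lower, hpS]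

theorem sum_lower_lt {c : ℕ → ℕ} {I S : Finset ℕ} (hS : S.Nonempty)
    (hSI : S ⊆ I.filter fun p => c p ≠ 0) : ∑ p ∈ I, lower c S p < ∑ p ∈ I, c p := by
  obtain ⟨a, ha⟩ := hS
  have haI := Finset.mem_filter.1 (hSI ha)
  refine Finset.sum_lt_sum (fun p _ => ?_) ⟨a, haI.1, ?_⟩
  · rw [lower]; split_ifs <;> omega
  · rw [lower, if_pos ha]; have := haI.2; omega

theorem sum_sdiff_lt {c : ℕ → ℕ} {I S : Finset ℕ} (hS : S.Nonempty)
    (hSI : S ⊆ I.filter fun p => c p ≠ 0) : ∑ p ∈ I \ S, c p < ∑ p ∈ I, c p := by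
  obtain ⟨a, ha⟩ := hS
  have haI := Finset.mem_filter.1 (hSI ha)
  refine Finset.sum_lt_sum_of_subset Finset.sdiff_subset haI.1 (by simp [ha])
    (Nat.pos_of_ne_zero haI.2) fun _ _ _ => Nat.zero_le _

/-! ### The complex of executions that extend a given one -/

/-- The union of the simplices with the vertices `view I₀ (u ++ w) p`, `p ∈ I`, where `w` runs
through the words for the counter `c` on `I`. -/
def protocol (I₀ : Finset ℕ) (u : List (Finset ℕ)) (c : ℕ → ℕ) (I : Finset ℕ) :
    Set (Table → ℝ) :=
  {x | ∃ w, IsWord c I w ∧ x ∈ closedSimplex (I.image (view I₀ (u ++ w)))}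

theorem image_view_subset {I₀ I I' : Finset ℕ} {w w' : List (Finset ℕ)} (h : I ⊆ I')
    (hv : ∀ p ∈ I, view I₀ w p = view I₀ w' p) :
    I.image (view I₀ w) ⊆ I'.image (view I₀ w') := by
  intro v hv'
  obtain ⟨p, hp, rfl⟩ := Finset.mem_image.1 hv'
  exact Finset.mem_image.2 ⟨p, h hp, (hv p hp).symm⟩

theorem subset_of_mem_append {I₀ : Finset ℕ} {u w : List (Finset ℕ)} (hu : ∀ C ∈ u, C ⊆ I₀)
    (hw : ∀ C ∈ w, C ⊆ I₀) : ∀ C ∈ u ++ w, C ⊆ I₀ := fun C hC =>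
  (List.mem_append.1 hC).elim (hu C) (hw C)

theorem subset_of_mem_cons {I₀ S : Finset ℕ} {w : List (Finset ℕ)} (hS : S ⊆ I₀)
    (hw : ∀ C ∈ w, C ⊆ I₀) : ∀ C ∈ S :: w, C ⊆ I₀ := fun C hC =>
  (List.mem_cons.1 hC).elim (fun e => e ▸ hS) (hw C)

/-- Executions are sorted by their next set; `hJ` rules out the empty word. -/
theorem protocol_eq_biUnion {I₀ : Finset ℕ} {u : List (Finset ℕ)} {c : ℕ → ℕ} {I : Finset ℕ}
    (hJ : (I.filter fun p => c p ≠ 0).Nonempty) :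
    protocol I₀ u c I = ⋃ S ∈ (I.filter fun p => c p ≠ 0).powerset.erase ∅,
      protocol I₀ (u ++ [S]) (lower c S) I := by
  ext x
  simp only [Set.mem_iUnion, Finset.mem_erase, Finset.mem_powerset, exists_prop]
  constructor
  · rintro ⟨w, hw, hx⟩
    cases w with
    | nil =>
      obtain ⟨p, hp⟩ := hJ
      rw [Finset.mem_filter] at hp
      exact absurd (hw.count p hp.1).symm (by simpa using hp.2)
    | cons S w =>
      obtain ⟨h1, h2, h3⟩ := isWord_cons.1 hw
      exact ⟨S, ⟨h1.ne_empty, h2⟩, w, h3, by simpa using hx⟩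
  · rintro ⟨S, ⟨h1, h2⟩, w, hw, hx⟩
    exact ⟨S :: w, isWord_cons.2 ⟨Finset.nonempty_iff_ne_empty.2 h1, h2, hw⟩, by simpa using hx⟩

/-- Executions in which the elements of `S` take no step after the set `S`, as executions that start
with `S`. -/
theorem protocol_sdiff_subset {I₀ S : Finset ℕ} {u : List (Finset ℕ)} {c : ℕ → ℕ} {I : Finset ℕ}
    (hu : ∀ C ∈ u, C ⊆ I₀) (hI : I ⊆ I₀) (hSI : S ⊆ I.filter fun p => c p ≠ 0) :
    protocol I₀ (u ++ [S]) c (I \ S) ⊆ protocol I₀ (u ++ [S]) (lower c S) I := by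
  have hS : S ⊆ I := hSI.trans (Finset.filter_subset _ _)
  rintro x ⟨w, hw, hx⟩
  -- The remaining steps of `S` are appended at the very end, where no process of `I \ S` sees them.
  obtain ⟨w', hw'⟩ := exists_isWord (lower c S) S
  refine ⟨w ++ w', ⟨?_, ?_, ?_⟩, closedSimplex_mono (image_view_subset Finset.sdiff_subset ?_) hx⟩
  · simp only [List.mem_append]
    rintro C (hC | hC)
    exacts [hw.nonempty C hC, hw'.nonempty C hC]
  · exact subset_of_mem_append (fun C hC => (hw.subset C hC).trans Finset.sdiff_subset)
      fun C hC => (hw'.subset C hC).trans hS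
  · intro p hp
    rw [List.countP_append]
    by_cases hpS : p ∈ S
    · rw [hw'.count p hpS, countP_mem_eq_zero, zero_add]
      exact fun C hC h => (Finset.mem_sdiff.1 (hw.subset C hC h)).2 hpS
    · rw [hw.count p (Finset.mem_sdiff.2 ⟨hp, hpS⟩), countP_mem_eq_zero (w := w'), lower,
        if_neg hpS, add_zero]
      exact fun C hC h => hpS (hw'.subset C hC h)
  · intro p hp
    rw [← List.append_assoc, view_append_of_notMem (w' := w')]
    · refine subset_of_mem_append (subset_of_mem_append hu (by simpa using hS.trans hI)) ?_
      exact fun C hC => (hw.subset C hC).trans (Finset.sdiff_subset.trans hI)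
    · exact fun C hC => (hw'.subset C hC).trans (hS.trans hI)
    · exact fun C hC h => (Finset.mem_sdiff.1 hp).2 (hw'.subset C hC h)

/-- Executions in which the elements of `S` take no step after the set `S`, as executions that start
with a larger set. -/
theorem exists_mem_protocol_of_mem_protocol_sdiff {I₀ S : Finset ℕ} {u : List (Finset ℕ)}
    {c : ℕ → ℕ} {I : Finset ℕ} (hu : ∀ C ∈ u, C ⊆ I₀) (hI : I ⊆ I₀)
    (hSI : S ⊂ I.filter fun p => c p ≠ 0) {x : Table → ℝ}
    (hx : x ∈ protocol I₀ (u ++ [S]) c (I \ S)) :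
    ∃ T, S ⊂ T ∧ T ⊆ I.filter (fun p => c p ≠ 0) ∧
      x ∈ protocol I₀ (u ++ [T]) (lower c T) I := by
  have hS : S ⊆ I := hSI.1.trans (Finset.filter_subset _ _)
  obtain ⟨w, hw, hx⟩ := hx
  cases w with
  | nil =>
    obtain ⟨p, hp, hpS⟩ := Finset.not_subset.1 hSI.2
    rw [Finset.mem_filter] at hp
    exact absurd (hw.count p (Finset.mem_sdiff.2 ⟨hp.1, hpS⟩)).symm (by simpa using hp.2)
  | cons T w =>
    obtain ⟨h1, h2, h3⟩ := isWord_cons.1 hw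
    have hTS : T ⊆ I \ S := h2.trans (Finset.filter_subset _ _)
    have hdisj : Disjoint S T := (Finset.subset_sdiff.1 hTS).2.symm
    have hwS : ∀ C ∈ w, Disjoint S C := fun C hC => (Finset.subset_sdiff.1 (h3.subset C hC)).2.symm
    have hwI : ∀ C ∈ w, C ⊆ I := fun C hC => (h3.subset C hC).trans Finset.sdiff_subset
    obtain ⟨w', hw'⟩ := exists_isWord (lower c S) S
    -- The set `S` is joined with the next set `T` of the word, which the processes outside `S` do
    -- not notice, and the remaining steps of `S` go to the end.
    refine ⟨S ∪ T, ?_, ?_, w ++ w', ⟨?_, ?_, ?_⟩,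
      closedSimplex_mono (image_view_subset Finset.sdiff_subset ?_) hx⟩
    · refine ⟨Finset.subset_union_left, fun h => ?_⟩
      obtain ⟨p, hp⟩ := h1
      exact Finset.disjoint_left.1 hdisj (h (Finset.mem_union_right _ hp)) hp
    · exact Finset.union_subset hSI.1
        (h2.trans (Finset.filter_subset_filter _ Finset.sdiff_subset))
    · simp only [List.mem_append]
      rintro C (hC | hC)
      exacts [h3.nonempty C hC, hw'.nonempty C hC]
    · exact subset_of_mem_append hwI fun C hC => (hw'.subset C hC).trans hS
    · intro p hp
      rw [List.countP_append]
      by_cases hpS : p ∈ S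
      · rw [hw'.count p hpS, countP_mem_eq_zero, zero_add]
        · simp [lower, hpS]
        · exact fun C hC h => Finset.disjoint_left.1 (hwS C hC) hpS h
      · rw [h3.count p (Finset.mem_sdiff.2 ⟨hp, hpS⟩), countP_mem_eq_zero (w := w')]
        · simp [lower, hpS]
        · exact fun C hC h => hpS (hw'.subset C hC h)
    · intro p hp
      have hpS := (Finset.mem_sdiff.1 hp).2
      have hTI : T ⊆ I := hTS.trans Finset.sdiff_subset
      rw [List.append_assoc, List.singleton_append,
        view_append_cons_cons hu (fun C hC => (hwI C hC).trans hI) (hS.trans hI)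
          (hTI.trans hI) hpS hdisj hwS, ← List.append_assoc, view_append_of_notMem (w' := w')]
      · simp
      · simp only [List.append_assoc, List.singleton_append]
        exact subset_of_mem_append hu (subset_of_mem_cons ((Finset.union_subset hS hTI).trans hI)
          fun C hC => (hwI C hC).trans hI)
      · exact fun C hC => (hw'.subset C hC).trans (hS.trans hI)
      · exact fun C hC h => hpS (hw'.subset C hC h)

/-- A point common to two simplices lies in the face of their common vertices. The processes of
these are outside `S` and see no later step of `S`, so deleting `S` from the rest of the first
execution preserves their views. -/
theorem protocol_inter_subset {I₀ S T : Finset ℕ} {u : List (Finset ℕ)} {c : ℕ → ℕ}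
    {I : Finset ℕ} (hu : ∀ C ∈ u, C ⊆ I₀) (hI : I ⊆ I₀) (hS : S ⊆ I) (hT : T ⊆ I)
    (hTS : ¬ T ⊆ S) :
    protocol I₀ (u ++ [S]) (lower c S) I ∩ protocol I₀ (u ++ [T]) (lower c T) I ⊆
      protocol I₀ (u ++ [S]) c (I \ S) := by
  rintro x ⟨⟨w, hw, hx⟩, ⟨w', hw', hx'⟩⟩
  rw [List.append_assoc, List.singleton_append] at hx hx'
  have hwI₀ : ∀ C ∈ w, C ⊆ I₀ := fun C hC => (hw.subset C hC).trans hI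
  have hw₁ : ∀ C ∈ u ++ S :: w, C ⊆ I₀ :=
    subset_of_mem_append hu (subset_of_mem_cons (hS.trans hI) hwI₀)
  have hw₂ : ∀ C ∈ u ++ T :: w', C ⊆ I₀ := subset_of_mem_append hu
    (subset_of_mem_cons (hT.trans hI) fun C hC => (hw'.subset C hC).trans hI)
  -- The continuation of the first execution with all later steps of `S` removed and emptied sets
  -- dropped.
  set w₀ := (w.map (· \ S)).filter (fun C => C.Nonempty) with hw₀
  have hw₀S : ∀ C ∈ w₀, C ⊆ I \ S := by
    intro C hC
    obtain ⟨C', hC', rfl⟩ := List.mem_map.1 (List.mem_filter.1 hC).1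
    exact Finset.sdiff_subset_sdiff (hw.subset C' hC') subset_rfl
  refine ⟨w₀, ⟨fun C hC => by simpa using (List.mem_filter.1 hC).2, hw₀S, fun p hp => ?_⟩,
    closedSimplex_mono ?_ (mem_closedSimplex_inter hx hx')⟩
  · rw [Finset.mem_sdiff] at hp
    have := hw.count p hp.1
    rw [lower, if_neg hp.2] at this
    rw [hw₀, List.countP_filter, List.countP_map, ← this]
    refine List.countP_congr fun C _ => ?_
    simp only [Function.comp_apply, Finset.mem_sdiff, hp.2, not_false_eq_true, and_true,
      Bool.and_eq_true, decide_eq_true_eq, and_iff_left_iff_imp]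
    exact fun h => ⟨p, by simp [h, hp.2]⟩
  · intro v hv
    obtain ⟨hv₁, hv₂⟩ := Finset.mem_inter.1 hv
    obtain ⟨p, hp, rfl⟩ := Finset.mem_image.1 hv₁
    obtain ⟨q, hq, hqp⟩ := Finset.mem_image.1 hv₂
    obtain rfl := eq_of_view_eq (hI hq) (hI hp) hqp
    have key := fun x (hx : x ∈ S) => notMem_upTo_of_view_eq hw₁ hw₂ hTS hqp.symm hx
    refine Finset.mem_image.2 ⟨q, Finset.mem_sdiff.2 ⟨hq, fun h => (key q h).1 rfl⟩, ?_⟩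
    obtain ⟨b, hb, hqb⟩ := exists_eq_upTo_append q w
    -- Up to the last step of `q` nothing is deleted, and what follows is invisible to `q`.
    have ha : ((upTo q w).map (· \ S)).filter (fun C => C.Nonempty) = upTo q w := by
      have h1 : (upTo q w).map (· \ S) = upTo q w := by
        conv_rhs => rw [← List.map_id (upTo q w)]
        refine List.map_congr_left fun C hC => ?_
        rw [id, Finset.sdiff_eq_self_iff_disjoint, Finset.disjoint_right]
        exact fun x hx => (key x hx).2 C hC
      rw [h1, List.filter_eq_self]
      intro C hC
      simpa using hw.nonempty C ((upTo_prefix q w).subset hC)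
    have hw₀' : w₀ = upTo q w ++ (b.map (· \ S)).filter (fun C => C.Nonempty) := by
      conv_lhs => rw [hw₀, hb, List.map_append, List.filter_append, ha]
    have hpre : ∀ C ∈ u ++ S :: upTo q w, C ⊆ I₀ := subset_of_mem_append hu
      (subset_of_mem_cons (hS.trans hI) fun C hC => hwI₀ C ((upTo_prefix q w).subset hC))
    have e1 : u ++ S :: w = (u ++ S :: upTo q w) ++ b := by
      conv_lhs => rw [hb]
      simp
    have e2 : u ++ [S] ++ w₀ =
        (u ++ S :: upTo q w) ++ (b.map (· \ S)).filter (fun C => C.Nonempty) := by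
      rw [hw₀']; simp
    rw [e1, e2, view_append_of_notMem hpre _ hqb, view_append_of_notMem hpre]
    · intro C hC
      exact (hw₀S C (by rw [hw₀']; exact List.mem_append_right _ hC)).trans
        (Finset.sdiff_subset.trans hI)
    · intro C hC hqC
      obtain ⟨C', hC', rfl⟩ := List.mem_map.1 (List.mem_filter.1 hC).1
      exact hqb C' hC' (Finset.mem_sdiff.1 hqC).1
    · exact fun C hC => hwI₀ C (by rw [hb]; exact List.mem_append_right _ hC)

/-! ### Gluing by the next set -/

theorem isClosed_isAbsoluteExtensor_protocol {I₀ : Finset ℕ} {u : List (Finset ℕ)} {c : ℕ → ℕ}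
    {I : Finset ℕ} (hu : ∀ C ∈ u, C ⊆ I₀) (hI : I ⊆ I₀) (hne : I.Nonempty) :
    IsClosed (protocol I₀ u c I) ∧ IsAbsoluteExtensor (protocol I₀ u c I) := by
  induction hn : ∑ p ∈ I, c p using Nat.strong_induction_on generalizing u c I with
  | _ n ih =>
  subst hn
  set J := I.filter fun p => c p ≠ 0 with hJ
  rcases J.eq_empty_or_nonempty with hJe | hJne
  · have hX : protocol I₀ u c I = closedSimplex (I.image (view I₀ u)) := by
      ext x
      have h0 : ∀ p ∈ I, c p = 0 := by simpa [hJ, Finset.filter_eq_empty_iff] using hJe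
      constructor
      · rintro ⟨w, hw, hx⟩
        cases w with
        | nil => simpa using hx
        | cons S w =>
          obtain ⟨h1, h2, -⟩ := isWord_cons.1 hw
          rw [← hJ, hJe, Finset.subset_empty] at h2
          exact absurd h2 h1.ne_empty
      · exact fun hx => ⟨[], ⟨by simp, by simp, fun p hp => by simp [h0 p hp]⟩, by simpa using hx⟩
    rw [hX]
    exact ⟨isClosed_closedSimplex _, isAbsoluteExtensor_closedSimplex (hne.image _)⟩
  rw [protocol_eq_biUnion hJne, ← hJ]
  set X : Finset ℕ → Set (Table → ℝ) := fun S => protocol I₀ (u ++ [S]) (lower c S) I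
  have hJI : J ⊆ I := Finset.filter_subset _ _
  have huS : ∀ S ⊆ J, ∀ C ∈ u ++ [S], C ⊆ I₀ := fun S hS =>
    subset_of_mem_append hu (by simpa using hS.trans (hJI.trans hI))
  have hX : ∀ S ⊆ J, S.Nonempty → IsClosed (X S) ∧ IsAbsoluteExtensor (X S) :=
    fun S hS hSne => ih _ (sum_lower_lt hSne hS) (huS S hS) hI hne rfl
  -- Families closed under passing to larger subsets of `J` are exactly the stages of the gluing;
  -- removing a minimal member gives the preceding stage.
  have main : ∀ n, ∀ F : Finset (Finset ℕ), F.card = n → F.Nonempty →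
      (∀ S ∈ F, S.Nonempty ∧ S ⊆ J) → (∀ S ∈ F, ∀ T, S ⊆ T → T ⊆ J → T ∈ F) →
      IsClosed (⋃ S ∈ F, X S) ∧ IsAbsoluteExtensor (⋃ S ∈ F, X S) := by
    intro n
    induction n with
    | zero => exact fun F hF hFne => absurd hF hFne.card_pos.ne'
    | succ n ihn =>
      intro F hF hFne hFJ hup
      obtain ⟨S, hSmin⟩ := F.exists_minimal hFne
      have hSF := hSmin.1
      obtain ⟨hSne, hSJ⟩ := hFJ S hSF
      have hSX := hX S hSJ hSne
      have hcl : IsClosed (⋃ S ∈ F, X S) :=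
        isClosed_biUnion_finset fun T hT => (hX T (hFJ T hT).2 (hFJ T hT).1).1
      refine ⟨hcl, ?_⟩
      have hdec : (⋃ T ∈ F, X T) = X S ∪ ⋃ T ∈ F.erase S, X T := by
        conv_lhs => rw [← Finset.insert_erase hSF]
        rw [Finset.set_biUnion_insert]
      rcases (F.erase S).eq_empty_or_nonempty with he | hne'
      · rw [hdec, he]
        simpa using hSX.2
      have hnot : ∀ T ∈ F.erase S, ¬ T ⊆ S := fun T hT h =>
        (Finset.mem_erase.1 hT).1 (h.antisymm (hSmin.2 (Finset.mem_erase.1 hT).2 h))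
      -- Another member of `F` is not contained in `S` but lies in `J`.
      have hSJ' : S ⊂ J := by
        obtain ⟨T, hT⟩ := hne'
        refine ⟨hSJ, fun h => hnot T hT (((hFJ T (Finset.mem_erase.1 hT).2).2).trans h)⟩
      have hrest := ihn (F.erase S) (by rw [Finset.card_erase_of_mem hSF, hF]; rfl) hne'
        (fun T hT => hFJ T (Finset.mem_erase.1 hT).2) (fun T hT T' hTT' hT' =>
          Finset.mem_erase.2 ⟨fun e => hnot T hT (e ▸ hTT'),
            hup T (Finset.mem_erase.1 hT).2 T' hTT' hT'⟩)
      -- The inclusion from left to right uses the minimality of `S`. For the converse, joining `S`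
      -- with the next set gives a strictly larger first set, which belongs to the family since it
      -- is closed upwards.
      have hinter : X S ∩ (⋃ T ∈ F.erase S, X T) = protocol I₀ (u ++ [S]) c (I \ S) := by
        refine Set.Subset.antisymm ?_ fun x hx => ⟨protocol_sdiff_subset hu hI hSJ hx, ?_⟩
        · rintro x ⟨hx, hx'⟩
          simp only [Set.mem_iUnion, exists_prop] at hx'
          obtain ⟨T, hT, hx'⟩ := hx'
          exact protocol_inter_subset hu hI (hSJ.trans hJI)
            ((hFJ T (Finset.mem_erase.1 hT).2).2.trans hJI) (hnot T hT) ⟨hx, hx'⟩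
        · obtain ⟨T, hST, hTJ, hxT⟩ := exists_mem_protocol_of_mem_protocol_sdiff hu hI hSJ' hx
          simp only [Set.mem_iUnion, exists_prop]
          exact ⟨T, Finset.mem_erase.2 ⟨hST.ne', hup S hSF T hST.1 hTJ⟩, hxT⟩
      rw [hdec]
      refine hSX.2.union hSX.1 hrest.1 hrest.2 ?_
      rw [hinter]
      refine (ih _ (sum_sdiff_lt hSne hSJ) (huS S hSJ) (Finset.sdiff_subset.trans hI) ?_ rfl).2
      obtain ⟨p, hp, hpS⟩ := Finset.not_subset.1 hSJ'.2
      exact ⟨p, Finset.mem_sdiff.2 ⟨hJI hp, hpS⟩⟩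
  refine main _ _ rfl ⟨J, ?_⟩ (fun S hS => ?_) fun S hS T hST hT => ?_
  · simpa using hJne.ne_empty
  · rw [Finset.mem_erase, Finset.mem_powerset] at hS
    exact ⟨Finset.nonempty_iff_ne_empty.2 hS.1, hS.2⟩
  · rw [Finset.mem_erase, Finset.mem_powerset] at hS ⊢
    refine ⟨fun e => hS.1 ?_, hT⟩
    rwa [e, Finset.subset_empty] at hST

/-! ### Facets of immediate snapshot complexes -/

/-- The values of a round counter on its support. -/
def RoundCounter.count (r : RoundCounter) (p : ℕ) : ℕ := (r.toFun p).unbotD 0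

theorem RoundCounter.coe_count {r : RoundCounter} {p : ℕ} (h : p ∈ r.supp) :
    (r.count p : WithBot ℕ) = r.toFun p := by
  have : r.toFun p ≠ ⊥ := by simpa [RoundCounter.supp] using h
  rw [RoundCounter.count]
  cases hp : r.toFun p with
  | bot => exact absurd hp this
  | coe n => rfl

theorem G_eq_empty_of_mem_schedule {I : Finset ℕ} {w : List (Finset ℕ)} {x : Pair}
    (hx : x ∈ (schedule I w).pairs) : x.G = ∅ := by
  rw [← Finset.subset_empty, ← ghost_schedule I w]
  exact fun p hp => mem_ghost.2 ⟨x, hx, hp⟩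

theorem isSimplexOf_schedule {r : RoundCounter} {w : List (Finset ℕ)}
    (hw : IsWord r.count r.supp w) : (schedule r.supp w).IsSimplexOf r where
  P1 := by
    intro x hx
    obtain ⟨S, hS, rfl⟩ := List.mem_map.1 hx
    exact ⟨hw.subset S hS, Finset.empty_subset _⟩
  P2 := List.pairwise_of_forall_mem_list fun x hx _ _ => by
    rw [G_eq_empty_of_mem_schedule hx]; exact Finset.disjoint_empty_left _
  P3_eq x hx := by
    rw [G_eq_empty_of_mem_schedule hx]; exact Finset.disjoint_empty_left _
  P3_lt := List.pairwise_of_forall_mem_list fun x hx _ _ => by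
    rw [G_eq_empty_of_mem_schedule hx]; exact Finset.disjoint_empty_left _
  nonempty_W := by
    intro x hx
    obtain ⟨S, hS, rfl⟩ := List.mem_map.1 hx
    exact hw.nonempty S hS
  supp_eq := supp_schedule _ _
  M_active := by
    intro p hp
    rw [active_schedule] at hp
    rw [← RoundCounter.coe_count hp, ← hw.count p hp]
    -- The initial pair contains every process and accounts for the `+ 1`.
    simp [M, pairs, schedule, column_R, hp, List.countP_map, Function.comp_def]
  M_ghost := by simp [ghost_schedule]

/-! ### Recovering a simplex from a facet -/

theorem mergeEmpty_empty_of_nonempty {l : List Pair} (h : ∀ x ∈ l, x.W.Nonempty) :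
    mergeEmpty ∅ l = l := by
  induction l with
  | nil => rfl
  | cons x l ih =>
    rw [mergeEmpty, if_neg (h x (by simp)).ne_empty, ih fun y hy => h y (by simp [hy]),
      Finset.empty_union]

/-- The disjointness axioms say that a ghost is in a lower entry exactly at its last occurrence, so
the sets `R` and the ghost set determine the table. The prefix `pre` is there because the ghost set
refers to the whole table during the induction on suffixes. -/
theorem retagAll_ghost {σ : Table} (h : σ.IsWitnessPrestructure)
    (pre l : List Pair) (hl : σ.pairs = pre ++ l) :
    retagAll σ.ghost (l.map fun x => column x.R) = l := by
  induction l generalizing pre with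
  | nil => rfl
  | cons x l ih =>
    have hU : unionR (l.map fun x => column x.R) = unionR l := by
      ext p; simp [mem_unionR, column_R]
    have h2 := h.P2
    have h3 := h.P3_lt
    rw [hl, List.pairwise_append] at h2 h3
    have hG : ∀ p ∈ x.G, p ∈ σ.ghost ∧ p ∉ unionR l := by
      intro p hp
      refine ⟨mem_ghost.2 ⟨x, by simp [hl], hp⟩, fun hp' => ?_⟩
      obtain ⟨y, hy, hpy⟩ := mem_unionR.1 hp'
      rcases Finset.mem_union.1 hpy with hpy | hpy
      · exact Finset.disjoint_left.1 ((List.pairwise_cons.1 h3.2.1).1 y hy) hp hpy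
      · exact Finset.disjoint_left.1 ((List.pairwise_cons.1 h2.2.1).1 y hy) hp hpy
    have hW : ∀ p ∈ x.W, p ∉ x.G ∧ (p ∈ σ.ghost → p ∈ unionR l) := by
      intro p hp
      have hpG : p ∉ x.G := fun hpG =>
        Finset.disjoint_left.1 (h.P3_eq x (by simp [hl])) hpG hp
      refine ⟨hpG, fun hpg => ?_⟩
      obtain ⟨y, hy, hpy⟩ := mem_ghost.1 hpg
      rw [hl, List.mem_append, List.mem_cons] at hy
      rcases hy with hy | rfl | hy
      · exact absurd hp (Finset.disjoint_left.1 (h3.2.2 y hy x (by simp)) hpy)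
      · exact absurd hpy hpG
      · exact mem_unionR.2 ⟨y, hy, Finset.mem_union_right _ hpy⟩
    have hx : retag σ.ghost (column x.R) (l.map fun x => column x.R) = x := by
      ext p <;>
      · have := hG p
        have := hW p
        simp only [retag, hU, column_R, Finset.mem_sdiff, Finset.mem_inter]
        simp only [Pair.R, Finset.mem_union]
        tauto
    rw [List.map_cons, retagAll, hx, ih (pre ++ [x]) (by simp [hl])]

theorem truncate_append_of_subset {D : Finset ℕ} {l l' : List Pair} (h : ∀ x ∈ l', x.R ⊆ D) :
    truncate D (l ++ l') = truncate D l := by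
  induction l' using List.reverseRecOn with
  | nil => simp
  | append_singleton l' x ih =>
    rw [← List.append_assoc, truncate, List.rdropWhile_concat_pos _ _ _ (by simp [h x])]
    exact ih fun y hy => h y (by simp [hy])

/-- An element of the last upper entry cannot be a ghost, as it would need a lower entry there or
later. So the last set `R` already stops the truncation. -/
theorem truncate_ghost_tail {σ : Table} (h : σ.IsWitnessStructure) :
    truncate σ.ghost (σ.tail.map fun x => column x.R) = σ.tail.map fun x => column x.R := by
  rcases List.eq_nil_or_concat σ.tail with ht | ⟨l, x, ht⟩
  · rw [ht]; rfl
  · have hre := retagAll_ghost h.toIsWitnessPrestructure (σ.head :: l) [x] (by simp [pairs, ht])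
    obtain ⟨p, hp⟩ := h.nonempty_W x (by simp [ht])
    simp only [List.map_cons, List.map_nil, retagAll, List.cons.injEq, and_true] at hre
    rw [← hre] at hp
    have hx : ¬ x.R ⊆ σ.ghost := fun hx => by
      simp only [retag, column_R, Finset.mem_sdiff, Finset.mem_inter, unionR] at hp
      exact hp.2 ⟨⟨hp.1, hx hp.1⟩, by simp⟩
    rw [ht, List.concat_eq_append, List.map_append, List.map_singleton, truncate,
      List.rdropWhile_concat_neg _ _ _ (by simpa [column_R] using hx)]

/-- Every simplex is a face of a simplex without ghosts. -/
theorem exists_Γ_schedule_eq {r : RoundCounter} {σ : Table} (h : σ.IsSimplexOf r) :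
    ∃ w, IsWord r.count r.supp w ∧ Γ σ.ghost (schedule r.supp w) = σ := by
  have hR := h.R_subset
  have hhead : σ.head.R = r.supp := h.supp_eq
  have hghost : σ.ghost ⊆ r.supp := h.supp_eq ▸ h.ghost_subset
  -- Each ghost is given the steps it lacks, `+ 1` for the initial pair. They are placed at the end,
  -- consist of ghosts only, and so are truncated again by ghosting.
  obtain ⟨w', hw'⟩ := exists_isWord (fun p => r.count p + 1 - σ.M p) σ.ghost
  refine ⟨σ.tail.map Pair.R ++ w', ⟨?_, ?_, ?_⟩, ?_⟩
  · simp only [List.mem_append, List.mem_map]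
    rintro _ (⟨x, hx, rfl⟩ | hS)
    · exact (h.nonempty_W x hx).mono Finset.subset_union_left
    · exact hw'.nonempty _ hS
  · simp only [List.mem_append, List.mem_map]
    rintro _ (⟨x, hx, rfl⟩ | hS)
    · exact (hR x hx).trans (Finset.subset_union_left.trans hhead.subset)
    · exact (hw'.subset _ hS).trans hghost
  · intro p hp
    have hM : σ.M p = σ.tail.countP (fun x => p ∈ x.R) + 1 := by
      simp [M, pairs, hhead, hp]
    rw [List.countP_append, List.countP_map]
    simp only [Function.comp_def]
    by_cases hpg : p ∈ σ.ghost
    · have := h.M_ghost p hpg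
      rw [← RoundCounter.coe_count hp] at this
      have : σ.M p ≤ r.count p + 1 := by exact_mod_cast this
      rw [hw'.count p hpg]
      omega
    · have := h.M_active p (by simp [active, h.supp_eq, hp, hpg])
      rw [← RoundCounter.coe_count hp] at this
      have : σ.M p = r.count p + 1 := by exact_mod_cast this
      rw [countP_mem_eq_zero (w := w') fun C hC hpC => hpg (hw'.subset C hC hpC)]
      omega
  · have ht : truncate σ.ghost ((σ.tail.map Pair.R ++ w').map column) =
        σ.tail.map fun x => column x.R := by
      rw [List.map_append, List.map_map, truncate_append_of_subset (by simpa [column_R] using hw'.subset)]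
      exact truncate_ghost_tail h.toIsWitnessStructure
    have hg : (⟨column r.supp, (σ.tail.map Pair.R ++ w').map column⟩ : Table).ghost = ∅ :=
      ghost_schedule _ _
    have hre := retagAll_ghost h.toIsWitnessPrestructure [] σ.pairs rfl
    rw [pairs, List.map_cons, retagAll, List.cons.injEq, hhead] at hre
    simp only [Γ, canon, st, schedule, hg, Finset.union_empty, ht, hre.1, hre.2,
      mergeEmpty_empty_of_nonempty h.nonempty_W]

/-- Every simplex lies in a facet given by a word, so the facets already cover the realization. -/
theorem realization_P (r : RoundCounter) :
    realization (P r) = protocol r.supp [] r.count r.supp := by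
  ext x
  constructor
  · rintro ⟨s, ⟨σ, hσ, -, rfl⟩, hx⟩
    obtain ⟨w, hw, hwσ⟩ := exists_Γ_schedule_eq hσ
    refine ⟨w, hw, closedSimplex_mono ?_ (show x ∈ closedSimplex _ from hx)⟩
    have hS : σ.ghost ⊆ (schedule r.supp w).active := by
      rw [active_schedule, ← hσ.supp_eq]
      exact hσ.ghost_subset
    conv_lhs => rw [← hwσ]
    rw [vertices_Γ (isSimplexOf_schedule hw).toIsWitnessPrestructure hS, active_schedule]
    exact Finset.image_subset_image Finset.sdiff_subset
  · rintro ⟨w, hw, hx⟩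
    have hne := nonempty_of_mem_closedSimplex hx
    refine ⟨_, ⟨schedule r.supp w, isSimplexOf_schedule hw, ?_, rfl⟩, ?_⟩
    · rw [active_schedule]; exact Finset.image_nonempty.1 hne
    · rw [vertices, active_schedule]; exact hx

/-- A countable vertex set makes `Table → ℝ` metrizable, as the passage from absolute extensors to
contractibility requires. -/
instance : Countable Table :=
  have : Countable Pair := Function.Injective.countable (f := fun x : Pair => (x.W, x.G))
    fun _ _ h => Pair.ext (Prod.ext_iff.1 h).1 (Prod.ext_iff.1 h).2
  Function.Injective.countable (f := fun σ : Table => (σ.head, σ.tail))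
    fun _ _ h => Table.ext (Prod.ext_iff.1 h).1 (Prod.ext_iff.1 h).2

end ImmediateSnapshot

theorem mainTheorem3 (r : ImmediateSnapshot.RoundCounter) (hr : r.supp.Nonempty) :
    ContractibleSpace (ImmediateSnapshot.realization (ImmediateSnapshot.P r)) := by
  open ImmediateSnapshot in
  rw [realization_P]
  refine (isClosed_isAbsoluteExtensor_protocol (by simp) subset_rfl hr).2.contractibleSpace ?_
  obtain ⟨w, hw⟩ := exists_isWord r.count r.supp
  obtain ⟨x, hx⟩ := closedSimplex_nonempty (hr.image (view r.supp ([] ++ w)))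
  exact ⟨x, w, hw, hx⟩
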